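/- Let $v\in\{2,3\}$, let $\mathcal A_2=\mathbb H$ be the quaternion skew field and $\mathcal A_3=\mathbb O$ the octonion algebra, and let $Y$ be a Banach space over $\mathcal A_v$: a real Banach space with continuous left and right multiplications by the elements of $\mathcal A_v$ such that $Y=Y_0i_0\oplus\dots\oplus Y_0i_{2^v-1}$, where $i_0=1,i_1,\dots$ are the standard generators of $\mathcal A_v$ and $Y_0$ is a real subspace whose vectors commute and associate with $\mathcal A_v$. Let $l_\infty(\mathbb Z,Y)$ be the Banach space of bounded sequences $x:\mathbb Z\to Y$ with the supremum norm. A sequence $(x_m)$ in $l_\infty(\mathbb Z,Y)$ is $c$-convergent to $x\in l_\infty(\mathbb Z,Y)$ if $\|x_m(k)-x(k)\|\to 0$ for each $k\in\mathbb Z$. A bounded real-linear operator $B$ on $l_\infty(\mathbb Z,Y)$ is $c$-continuous if it maps every norm-bounded $c$-convergent sequence to a $c$-convergent sequence. For a natural number $n\ge 1$ it is $n$-periodic if it is $c$-continuous and $S(n)B=BS(n)$, where $(S(n)x)(k)=x(n+k)$. For a real Banach space $E$ let $E\oplus E\mathbf i$ be its complexification, with $\|a+b\mathbf i\|^2=\|a\|^2+\|b\|^2$;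 a bounded real-linear operator $B$ is extended to complexifications by $\mathbf B(a+b\mathbf i)=Ba+(Bb)\mathbf i$. Let $\mathbf S^1$ be the set of complex numbers $M=s+t\mathbf i$ with $|M|=1$. For $x=(x_0,\dots,x_{n-1})\in(Y\oplus Y\mathbf i)^n$, regarded as an $n$-periodic sequence, let $D(\mathcal M)x$ be the bounded sequence $k\mapsto M^k x_{k \bmod n}$. The Fourier transform of an $n$-periodic operator $B$ at $M\in\mathbf S^1$ is the bounded operator $\hat B(M)$ on $(Y\oplus Y\mathbf i)^n$ (with the maximum norm) given by $$\hat B(M)x=\bigl((\mathbf B D(\mathcal M)x)(0),\dots,(\mathbf B D(\mathcal M)x)(n-1)\bigr).$$ Theorem 82. Let $B$ be an $n$-periodic operator on $l_\infty(\mathbb Z,Y)$. Then the following conditions are equivalent: (1) $B$ is invertible, that is, has a bounded real-linear two-sided inverse on $l_\infty(\mathbb Z,Y)$; (2) for each $M\in\mathbf S^1$ the operator $\hat B(M)$ is invertible, that is, has a bounded real-linear two-sided inverse on $(Y\oplus Y\mathbf i)^n$. -/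

import Mathlib

open scoped ENNReal

noncomputable section

/-! ### Cayley-Dickson algebras -/

/-- The underlying real vector space of the Cayley-Dickson algebra `𝒜_v`:
`𝒜_0 = ℝ`, and `𝒜_{v+1} = 𝒜_v ⊕ 𝒜_v l`. So `𝒜_2` is the quaternion skew field and `𝒜_3` the
octonion algebra. -/
def CayleyDickson : ℕ → Type
  | 0 => ℝ
  | v + 1 => CayleyDickson v × CayleyDickson v

namespace CayleyDickson

instance instAddCommGroup : (v : ℕ) → AddCommGroup (CayleyDickson v)
  | 0 => inferInstanceAs (AddCommGroup ℝ)
  | v + 1 =>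
    letI := instAddCommGroup v
    inferInstanceAs (AddCommGroup (CayleyDickson v × CayleyDickson v))

instance instModule : (v : ℕ) → Module ℝ (CayleyDickson v)
  | 0 => inferInstanceAs (Module ℝ ℝ)
  | v + 1 =>
    letI := instModule v
    inferInstanceAs (Module ℝ (CayleyDickson v × CayleyDickson v))

/-- The unit. -/
def one : (v : ℕ) → CayleyDickson v
  | 0 => (1 : ℝ)
  | v + 1 => (one v, 0)

/-- The conjugation `(a + b l)^* = a^* - b l`. -/
def conj : (v : ℕ) → CayleyDickson v → CayleyDickson v
  | 0, a => a
  | v + 1, (a, b) => (conj v a, -b)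

/-- The multiplication `(a + b l)(c + d l) = (a c - d^* b) + (d a + b c^*) l`. -/
def mul : (v : ℕ) → CayleyDickson v → CayleyDickson v → CayleyDickson v
  | 0, a, b => Mul.mul (α := ℝ) a b
  | v + 1, (a, b), (c, d) =>
    (mul v a c - mul v (conj v d) b, mul v d a + mul v b (conj v c))

instance (v : ℕ) : One (CayleyDickson v) := ⟨one v⟩

instance (v : ℕ) : Mul (CayleyDickson v) := ⟨mul v⟩

/-- The standard generators `i_0 = 1, i_1, …, i_{2^v - 1}` (the index is only used below `2 ^ v`). -/
def gen : (v : ℕ) → ℕ → CayleyDickson v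
  | 0, _ => (1 : ℝ)
  | v + 1, j => if j < 2 ^ v then (gen v j, 0) else (0, gen v (j - 2 ^ v))

end CayleyDickson

/-- The structure of a (two-sided) `𝒜_v` vector space with continuous multiplications on a real
normed space `Y`; for complete `Y`, this makes `Y` a Banach space over `𝒜_v`. There are continuous
left and right multiplications by Cayley-Dickson numbers, additive in both arguments and compatible
with the real scalars, and `Y = Y₀ i_0 ⊕ Y₀ i_1 ⊕ … ⊕ Y₀ i_{2^v - 1}` for a real subspace `Y₀`
whose vectors commute and associate with the Cayley-Dickson numbers. -/
class CayleyDicksonSpace (v : ℕ) (Y : Type*) [NormedAddCommGroup Y] [NormedSpace ℝ Y] where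
  /-- `lmul a y = a y` -/
  lmul : CayleyDickson v →ₗ[ℝ] (Y →L[ℝ] Y)
  /-- `rmul a y = y a` -/
  rmul : CayleyDickson v →ₗ[ℝ] (Y →L[ℝ] Y)
  /-- The subspace `Y₀`. -/
  realPart : Submodule ℝ Y
  lmul_one : ∀ y, lmul 1 y = y
  rmul_one : ∀ y, rmul 1 y = y
  lmul_eq_rmul : ∀ a, ∀ y ∈ realPart, lmul a y = rmul a y
  lmul_lmul : ∀ a b, ∀ y ∈ realPart, lmul a (lmul b y) = lmul (a * b) y
  rmul_rmul : ∀ a b, ∀ y ∈ realPart, rmul b (rmul a y) = rmul (a * b) y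
  existsUnique_components : ∀ y : Y, ∃! c : Fin (2 ^ v) → realPart,
    y = ∑ j : Fin (2 ^ v), lmul (CayleyDickson.gen v j) (c j)

/-! ### Operators on bounded two-sided sequences -/

section Sequences

variable (Y : Type*) [NormedAddCommGroup Y] [NormedSpace ℝ Y]

/-- `l_∞(ℤ, Y)` with the supremum norm. -/
abbrev LInfty : Type _ := lp (fun _ : ℤ => Y) ∞

variable {Y}

/-- A bounded sequence as an element of `l_∞(ℤ, Y)`. -/
def LInfty.mk (x : ℤ → Y) (C : ℝ) (h : ∀ k, ‖x k‖ ≤ C) : LInfty Y :=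
  ⟨x, memℓp_infty ⟨C, by rintro _ ⟨k, rfl⟩; exact h k⟩⟩

/-- `c`-convergence of a sequence of elements of `l_∞(ℤ, Y)`: coordinatewise convergence in norm. -/
def CConverges (x : ℕ → LInfty Y) (y : LInfty Y) : Prop :=
  ∀ k : ℤ, Filter.Tendsto (fun m => ‖x m k - y k‖) Filter.atTop (nhds 0)

/-- `c`-continuity of a bounded real-linear operator: it maps every norm-bounded `c`-convergent
sequence to a `c`-convergent sequence. (An operator that does this for all `c`-convergent
sequences, norm-bounded or not, is in particular `c`-continuous.) -/
def CContinuous (B : LInfty Y →L[ℝ] LInfty Y) : Prop :=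
  ∀ (x : ℕ → LInfty Y) (y : LInfty Y), (∃ C : ℝ, ∀ m, ‖x m‖ ≤ C) → CConverges x y →
    ∃ z : LInfty Y, CConverges (fun m => B (x m)) z

/-- The shift operator `(S(n) x)(k) = x(n + k)`. -/
def shift (n : ℤ) : LInfty Y →L[ℝ] LInfty Y :=
  LinearMap.mkContinuous
    { toFun := fun x => LInfty.mk (fun k => x (n + k)) ‖x‖
        fun k => lp.norm_apply_le_norm ENNReal.top_ne_zero x (n + k)
      map_add' := fun _ _ => rfl
      map_smul' := fun _ _ => rfl } 1
    fun x => by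
      rw [one_mul]
      exact lp.norm_le_of_forall_le (norm_nonneg x)
        fun k => lp.norm_apply_le_norm ENNReal.top_ne_zero x (n + k)

/-- `B` is an `n`-periodic operator: a `c`-continuous bounded real-linear operator that commutes
with the shift `S(n)`. -/
def IsPeriodicOperator (n : ℕ) (B : LInfty Y →L[ℝ] LInfty Y) : Prop :=
  CContinuous B ∧ (shift n).comp B = B.comp (shift n)

end Sequences

/-! ### Complexification and the Fourier transform -/

/-- The complexification `E ⊕ E 𝐢`; the pair `(a, b)` stands for `a + b 𝐢`, and
`‖a + b 𝐢‖ ^ 2 = ‖a‖ ^ 2 + ‖b‖ ^ 2`. -/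
abbrev Cplx (E : Type*) : Type _ := WithLp 2 (E × E)

section Cplx

variable {E : Type*} [NormedAddCommGroup E] [NormedSpace ℝ E]

/-- The extension `𝐁(a + b 𝐢) = B a + (B b) 𝐢`. -/
def Cplx.map {F : Type*} [NormedAddCommGroup F] [NormedSpace ℝ F] (B : E →L[ℝ] F) :
    Cplx E →L[ℝ] Cplx F :=
  ((WithLp.prodContinuousLinearEquiv 2 ℝ F F).symm : F × F →L[ℝ] Cplx F).comp
    ((B.prodMap B).comp (WithLp.prodContinuousLinearEquiv 2 ℝ E E : Cplx E →L[ℝ] E × E))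

/-- Multiplication by a complex number:
`(s + t 𝐢)(a + b 𝐢) = (s a - t b) + (t a + s b) 𝐢`. -/
def Cplx.cmul (z : ℂ) (x : Cplx E) : Cplx E :=
  WithLp.toLp 2 (z.re • x.fst - z.im • x.snd, z.im • x.fst + z.re • x.snd)

end Cplx

section Fourier

variable {Y : Type*} [NormedAddCommGroup Y] [NormedSpace ℝ Y]

/-- The residue of `k` modulo `n` in `{0, …, n - 1}`. -/
def residue (n : ℕ) [NeZero n] (k : ℤ) : Fin n :=
  ⟨(k % n).toNat, by
    have h0 : 0 < n := Nat.pos_of_neZero n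
    have h1 := Int.emod_lt_of_pos k (b := n) (by exact_mod_cast h0)
    omega⟩

theorem norm_cmul_circle_le {n : ℕ} (M : Circle) (k : ℤ) (x : Fin n → Cplx Y) (j : Fin n) :
    ‖(Cplx.cmul ((M ^ k : Circle) : ℂ) (x j)).fst‖ ≤ 2 * ‖x‖ ∧
      ‖(Cplx.cmul ((M ^ k : Circle) : ℂ) (x j)).snd‖ ≤ 2 * ‖x‖ := by
  have h1 : |((M ^ k : Circle) : ℂ).re| ≤ 1 :=
    (Complex.abs_re_le_norm _).trans (Circle.norm_coe _).le
  have h2 : |((M ^ k : Circle) : ℂ).im| ≤ 1 :=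
    (Complex.abs_im_le_norm _).trans (Circle.norm_coe _).le
  have h3 : ‖(x j).fst‖ ≤ ‖x‖ := (WithLp.norm_fst_le _ _).trans (norm_le_pi_norm x j)
  have h4 : ‖(x j).snd‖ ≤ ‖x‖ := (WithLp.norm_snd_le _ _).trans (norm_le_pi_norm x j)
  have key : ∀ (t : ℝ) (y : Y), |t| ≤ 1 → ‖y‖ ≤ ‖x‖ → ‖t • y‖ ≤ ‖x‖ := fun t y ht hy => by
    rw [norm_smul, Real.norm_eq_abs]
    exact (mul_le_of_le_one_left (norm_nonneg y) ht).trans hy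
  constructor
  · refine (norm_sub_le _ _).trans ?_
    linarith [key _ _ h1 h3, key _ _ h2 h4]
  · refine (norm_add_le _ _).trans ?_
    linarith [key _ _ h2 h3, key _ _ h1 h4]

/-- The real component of `D(𝓜) x`, see `diagMul`. -/
def diagMulFst (n : ℕ) [NeZero n] (M : Circle) : (Fin n → Cplx Y) →L[ℝ] LInfty Y :=
  LinearMap.mkContinuous
    { toFun := fun x => LInfty.mk
        (fun k => (Cplx.cmul ((M ^ k : Circle) : ℂ) (x (residue n k))).fst) (2 * ‖x‖)
        fun k => (norm_cmul_circle_le M k x _).1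
      map_add' := fun x y => by
        ext k
        rw [lp.coeFn_add, Pi.add_apply]
        simp [LInfty.mk, Cplx.cmul, smul_add]
        abel
      map_smul' := fun r x => by
        ext k
        simp [LInfty.mk, Cplx.cmul, smul_sub, smul_comm r] } 2
    fun x => lp.norm_le_of_forall_le (by positivity) fun k => (norm_cmul_circle_le M k x _).1

/-- The imaginary component of `D(𝓜) x`, see `diagMul`. -/
def diagMulSnd (n : ℕ) [NeZero n] (M : Circle) : (Fin n → Cplx Y) →L[ℝ] LInfty Y :=
  LinearMap.mkContinuous
    { toFun := fun x => LInfty.mk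
        (fun k => (Cplx.cmul ((M ^ k : Circle) : ℂ) (x (residue n k))).snd) (2 * ‖x‖)
        fun k => (norm_cmul_circle_le M k x _).2
      map_add' := fun x y => by
        ext k
        rw [lp.coeFn_add, Pi.add_apply]
        simp [LInfty.mk, Cplx.cmul, smul_add]
        abel
      map_smul' := fun r x => by
        ext k
        simp [LInfty.mk, Cplx.cmul, smul_add, smul_comm r] } 2
    fun x => lp.norm_le_of_forall_le (by positivity) fun k => (norm_cmul_circle_le M k x _).2

/-- `D(𝓜) x`, the bounded sequence `k ↦ M ^ k x_{k mod n}` with values in `Y ⊕ Y 𝐢`, written as an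
element of `l_∞(ℤ, Y) ⊕ l_∞(ℤ, Y) 𝐢`. Here `M` is a complex number with `|M| = 1`, and the vector
`x = (x_0, …, x_{n-1})` of `(Y ⊕ Y 𝐢)^n` is read as an `n`-periodic sequence. -/
def diagMul (n : ℕ) [NeZero n] (M : Circle) : (Fin n → Cplx Y) →L[ℝ] Cplx (LInfty Y) :=
  ((WithLp.prodContinuousLinearEquiv 2 ℝ (LInfty Y) (LInfty Y)).symm :
      LInfty Y × LInfty Y →L[ℝ] Cplx (LInfty Y)).comp
    ((diagMulFst n M).prod (diagMulSnd n M))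

/-- The Fourier transform of an `n`-periodic operator `B`, an operator on `(Y ⊕ Y 𝐢)^n` with the
maximum norm: `B̂(M) x = ((𝐁 D(𝓜) x)(0), …, (𝐁 D(𝓜) x)(n - 1))`, where `𝐁` is the extension of `B`
to the complexification. -/
def fourierTransform (n : ℕ) [NeZero n] (B : LInfty Y →L[ℝ] LInfty Y) (M : Circle) :
    (Fin n → Cplx Y) →L[ℝ] (Fin n → Cplx Y) :=
  ContinuousLinearMap.pi fun j =>
    (Cplx.map (lp.evalCLM ℝ (fun _ : ℤ => Y) ∞ ((j : ℕ) : ℤ))).comp ((Cplx.map B).comp (diagMul n M))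

end Fourier

end

noncomputable section

/-! ### Spectra in real Banach algebras -/

/-! Write k = nq + r with 0 ≤ r < n. Since M^k = (M^n)^q M^r, the sequence D(M)x satisfies x_{n+k} =
z x_k with z = M^n, and up to the invertible `twist` the Fourier transform at M is the restriction
of B to the eigenspace of S(n) for z, coordinatized by the block 0, …, n - 1 (`symbol`,
`fourierTransform_eq_symbol`). An inverse of B commutes with S(n), hence preserves these eigenspaces
and inverts every restriction.

The converse is a local principle in the real Banach algebra of operators on complexified bounded
sequences that commute with U = S(n) and with the imaginary unit, both of which are central there
(`periodicAlgebra`). If a has no left inverse, it lies in a maximal left ideal L. By a Schur-type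
argument a central element acts bijectively on the quotient by L or belongs to L. Nonempty spectrum,
in the real form `exists_not_isUnit_quadratic`, then yields a complex z with U - z in L, and power
boundedness of U and its inverse forces |z| = 1. So a is left invertible as soon as, for each z on
the circle, it has a left inverse modulo the closed ideal generated by U - z
(`exists_left_inverse`); the opposite algebra gives the right inverse.

The inverse of the symbol at z, applied block by block, is such a local inverse: the error C
vanishes on the eigenspace for z. It remains to see that C lies in the closed ideal generated by U -
z (`exists_norm_mul_cesaro_le`). Cesàro means of the powers of U/z differ from 1 by multiples of U -
z, so it suffices that C times these means gets small. The means produce vectors almost fixed by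
U/z, hence coordinatewise close to quasi-periodic ones, which C kills; c-continuity makes the images
small on the block 0, …, n - 1, and translation invariance turns this into smallness in norm. -/

/-- The complexification of a real normed space `V` as the space of real-linear maps `ℂ → V`, with
the complex structure `(z f)(w) = f (w z)`. The operator norm is homogeneous over `ℂ`. -/
def RealHom (V : Type*) [NormedAddCommGroup V] [NormedSpace ℝ V] : Type _ := ℂ →L[ℝ] V

namespace RealHom

variable {V : Type*} [NormedAddCommGroup V] [NormedSpace ℝ V]

instance : NormedAddCommGroup (RealHom V) := inferInstanceAs (NormedAddCommGroup (ℂ →L[ℝ] V))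

instance [CompleteSpace V] : CompleteSpace (RealHom V) :=
  inferInstanceAs (CompleteSpace (ℂ →L[ℝ] V))

instance : Module ℂ (RealHom V) where
  smul z f := ContinuousLinearMap.comp (show ℂ →L[ℝ] V from f) (ContinuousLinearMap.mul ℝ ℂ z)
  one_smul f := ContinuousLinearMap.ext fun w => congrArg (show ℂ →L[ℝ] V from f) (one_mul w)
  mul_smul z w f := ContinuousLinearMap.ext fun u =>
    congrArg (show ℂ →L[ℝ] V from f) (by simp; ring)
  smul_zero z := rfl
  smul_add z f g := rfl
  add_smul z w f := ContinuousLinearMap.ext fun u =>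
    (congrArg (show ℂ →L[ℝ] V from f) (add_mul z w u)).trans
      (map_add (show ℂ →L[ℝ] V from f) _ _)
  zero_smul f := ContinuousLinearMap.ext fun u =>
    (congrArg (show ℂ →L[ℝ] V from f) (zero_mul u)).trans (map_zero (show ℂ →L[ℝ] V from f))

instance : NormedSpace ℂ (RealHom V) where
  norm_smul_le z f := by
    refine (ContinuousLinearMap.opNorm_comp_le _ _).trans ?_
    rw [mul_comm]
    exact mul_le_mul_of_nonneg_right (ContinuousLinearMap.opNorm_mul_apply_le ℝ ℂ z)
      (norm_nonneg _)

instance [Nontrivial V] : Nontrivial (RealHom V) :=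
  inferInstanceAs (Nontrivial (ℂ →L[ℝ] V))

/-- A real-linear operator acts on the complexification. -/
def lift (T : V →L[ℝ] V) : RealHom V →L[ℂ] RealHom V :=
  LinearMap.mkContinuous
    { toFun := fun f => T.comp (show ℂ →L[ℝ] V from f)
      map_add' := fun f g => ContinuousLinearMap.comp_add T f g
      map_smul' := fun _ _ => rfl } ‖T‖
    fun f => ContinuousLinearMap.opNorm_comp_le T f

theorem lift_mul (S T : V →L[ℝ] V) : lift (S * T) = lift S * lift T := rfl

theorem lift_one : lift (1 : V →L[ℝ] V) = 1 := rfl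

theorem lift_add (S T : V →L[ℝ] V) : lift (S + T) = lift S + lift T :=
  ContinuousLinearMap.ext fun f => ContinuousLinearMap.add_comp S T f

theorem lift_smul (r : ℝ) (T : V →L[ℝ] V) : lift (r • T) = (r : ℂ) • lift T := by
  refine ContinuousLinearMap.ext fun f => ContinuousLinearMap.ext fun w => ?_
  change r • T ((show ℂ →L[ℝ] V from f) w) = T ((show ℂ →L[ℝ] V from f) ((r : ℂ) * w))
  rw [← Complex.real_smul, map_smul, map_smul]

end RealHom

/-- For every operator `T` on a nontrivial real Banach space there is a complex number `z` such that
`(T - z)(T - conj z)` is not invertible. -/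
theorem exists_not_isUnit_quadratic {V : Type*} [NormedAddCommGroup V] [NormedSpace ℝ V]
    [CompleteSpace V] [Nontrivial V] (T : V →L[ℝ] V) :
    ∃ z : ℂ, ¬ IsUnit (T * T + (-2 * z.re) • T + (Complex.normSq z) • (1 : V →L[ℝ] V)) := by
  obtain ⟨z, hz⟩ := spectrum.nonempty (A := RealHom V →L[ℂ] RealHom V) (RealHom.lift T)
  refine ⟨z, fun h => hz ?_⟩
  have hu : IsUnit (RealHom.lift (T * T + (-2 * z.re) • T + (Complex.normSq z) • 1)) := by
    obtain ⟨⟨a, b, hab, hba⟩, h⟩ := h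
    rw [← h]
    exact ⟨⟨RealHom.lift a, RealHom.lift b, by rw [← RealHom.lift_mul, hab, RealHom.lift_one],
      by rw [← RealHom.lift_mul, hba, RealHom.lift_one]⟩, rfl⟩
  -- Over ℂ the real quadratic splits into commuting factors, so its invertibility would make z - T
  -- invertible, against the choice of z in the spectrum.
  have hfac : RealHom.lift (T * T + (-2 * z.re) • T + (Complex.normSq z) • 1) =
      (algebraMap ℂ _ z - RealHom.lift T) *
        (algebraMap ℂ _ ((starRingEnd ℂ) z) - RealHom.lift T) := by
    rw [RealHom.lift_add, RealHom.lift_add, RealHom.lift_mul, RealHom.lift_smul,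
      RealHom.lift_smul, RealHom.lift_one]
    simp only [Algebra.algebraMap_eq_smul_one, mul_sub, sub_mul, smul_mul_assoc, mul_smul_comm,
      one_mul, mul_one, Complex.normSq_eq_conj_mul_self]
    have : ((-2 * z.re : ℝ) : ℂ) = -(z + (starRingEnd ℂ) z) := by
      rw [Complex.add_conj]; push_cast; ring
    rw [this]
    module
  rw [hfac] at hu
  have hc : Commute (algebraMap ℂ (RealHom V →L[ℂ] RealHom V) z - RealHom.lift T)
      (algebraMap ℂ _ ((starRingEnd ℂ) z) - RealHom.lift T) :=
    (Algebra.commute_algebraMap_left _ _).sub_left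
      ((Algebra.commute_algebraMap_right _ _).sub_right (Commute.refl _))
  exact (hc.isUnit_mul_iff.1 hu).1

/-! ### One-sided invertibility over a central element -/

section Ideals

variable {A : Type*} [NormedRing A] [NormedAlgebra ℝ A]

/-- The left action of a Banach algebra on its quotient by a left ideal. -/
def quotientAction (L : Ideal A) (a : A) : (A ⧸ L) →L[ℝ] (A ⧸ L) where
  toFun x := a • x
  map_add' := smul_add a
  map_smul' r x := (smul_comm r a x).symm
  cont := by
    have h : Topology.IsQuotientMap (Submodule.Quotient.mk : A → A ⧸ L) :=
      isQuotientMap_quotient_mk'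
    refine h.continuous_iff.2 ?_
    exact h.continuous.comp (continuous_const_mul a)

theorem quotientAction_mk (L : Ideal A) (a b : A) :
    quotientAction L a (Submodule.Quotient.mk b) = Submodule.Quotient.mk (a * b) := rfl

/-- A central element that does not act invertibly on the quotient by a maximal left ideal belongs
to the ideal. -/
theorem mem_of_not_isUnit_quotientAction [CompleteSpace A] (L : Ideal A) [hL : L.IsMaximal] {c : A}
    (hc : ∀ x, Commute c x) (h : ¬ IsUnit (quotientAction L c)) : c ∈ L := by
  by_contra hcL
  refine h (ContinuousLinearMap.isUnit_iff_bijective.2 ⟨?_, ?_⟩)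
  · rw [injective_iff_map_eq_zero]
    intro x hx
    obtain ⟨b, rfl⟩ := Submodule.Quotient.mk_surjective L x
    rw [quotientAction_mk, Submodule.Quotient.mk_eq_zero] at hx
    rw [Submodule.Quotient.mk_eq_zero]
    -- K is a left ideal because c is central. It contains L and is proper because c is not in L, so
    -- K = L by maximality; this is injectivity.
    let K : Ideal A :=
      { carrier := {b | c * b ∈ L}
        add_mem' := fun {a b} ha hb => by
          simpa only [Set.mem_ofPred_eq, mul_add] using L.add_mem ha hb
        zero_mem' := by simp
        smul_mem' := fun r b hb => by
          have : c * (r * b) = r * (c * b) := by rw [← mul_assoc, (hc r).eq, mul_assoc]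
          simpa only [Set.mem_ofPred_eq, smul_eq_mul, this] using L.mul_mem_left r hb }
    have hLK : L ≤ K := fun b hb => L.mul_mem_left c hb
    have hK : K ≠ ⊤ := fun hK => hcL (by
      have : (1 : A) ∈ K := hK ▸ Submodule.mem_top
      simpa [K] using this)
    rw [hL.eq_of_le hK hLK]
    exact hx
  · intro x
    obtain ⟨b, rfl⟩ := Submodule.Quotient.mk_surjective L x
    -- Maximality also gives L + Ac = A, which is surjectivity.
    have hsup : L ⊔ Ideal.span {c} = ⊤ := by
      by_contra hne
      exact hcL (hL.eq_of_le hne le_sup_left ▸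
        (le_sup_right : Ideal.span {c} ≤ _) (Ideal.mem_span_singleton_self c))
    have hb : b ∈ L ⊔ Ideal.span {c} := hsup ▸ Submodule.mem_top
    obtain ⟨l, hl, y, hy, rfl⟩ := Submodule.mem_sup.1 hb
    obtain ⟨d, rfl⟩ := Ideal.mem_span_singleton'.1 hy
    refine ⟨Submodule.Quotient.mk d, ?_⟩
    rw [quotientAction_mk, Submodule.Quotient.eq, (hc d).eq]
    simpa using L.neg_mem hl

theorem commute_liftAux {J : A} (hJ : ∀ x, Commute J x) (hJJ : J * J = -1) (z : ℂ) (x : A) :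
    Commute (Complex.liftAux J hJJ z) x := by
  rw [Complex.liftAux_apply]
  exact (Algebra.commute_algebraMap_left _ _).add_left ((hJ x).smul_left _)

/-- A maximal left ideal contains `U - z` for some complex number `z`. -/
theorem exists_sub_mem_of_isMaximal [CompleteSpace A] (L : Ideal A) [hL : L.IsMaximal] {U J : A}
    (hU : ∀ x, Commute U x) (hJ : ∀ x, Commute J x) (hJJ : J * J = -1) :
    ∃ z : ℂ, U - Complex.liftAux J hJJ z ∈ L := by
  have : Nontrivial (A ⧸ L) := Submodule.Quotient.nontrivial_iff.2 hL.ne_top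
  obtain ⟨z, hz⟩ := exists_not_isUnit_quadratic (quotientAction L U)
  by_contra! hcon
  -- If no U - w were in L, both factors of the quadratic from `hz` would act invertibly on the
  -- quotient.
  have key : ∀ w : ℂ, IsUnit (quotientAction L (U - Complex.liftAux J hJJ w)) := fun w => by
    by_contra hw
    exact hcon w (mem_of_not_isUnit_quotientAction L
      (fun x => (hU x).sub_left (commute_liftAux hJ hJJ w x)) hw)
  refine hz ?_
  convert (key z).mul (key ((starRingEnd ℂ) z)) using 1
  refine ContinuousLinearMap.ext fun x => ?_
  obtain ⟨b, rfl⟩ := Submodule.Quotient.mk_surjective L x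
  have h1 : (U - Complex.liftAux J hJJ z) * (U - Complex.liftAux J hJJ ((starRingEnd ℂ) z)) =
      U * U + (-2 * z.re) • U + Complex.normSq z • 1 := by
    have h2 : Complex.liftAux J hJJ z + Complex.liftAux J hJJ ((starRingEnd ℂ) z) =
        (2 * z.re) • (1 : A) := by
      rw [← map_add, Complex.add_conj, Complex.liftAux_apply]
      simp [Algebra.algebraMap_eq_smul_one]
    have h3 : Complex.liftAux J hJJ z * Complex.liftAux J hJJ ((starRingEnd ℂ) z) =
        Complex.normSq z • (1 : A) := by
      rw [← map_mul, Complex.mul_conj, Complex.liftAux_apply]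
      simp [Algebra.algebraMap_eq_smul_one]
    rw [sub_mul, mul_sub, mul_sub, h3, (commute_liftAux hJ hJJ z U).eq]
    have h4 : U * Complex.liftAux J hJJ ((starRingEnd ℂ) z) =
        (2 * z.re) • U - U * Complex.liftAux J hJJ z := by
      rw [eq_sub_iff_add_eq, add_comm, ← mul_add, h2, mul_smul_comm, mul_one]
    rw [h4]
    module
  change _ = Submodule.Quotient.mk ((U - Complex.liftAux J hJJ z) *
    ((U - Complex.liftAux J hJJ ((starRingEnd ℂ) z)) * b))
  rw [← mul_assoc, h1, add_mul, add_mul, smul_mul_assoc, smul_mul_assoc, one_mul, mul_assoc]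
  rfl

theorem norm_liftAux_le {J : A} (hJJ : J * J = -1) (z : ℂ) :
    ‖Complex.liftAux J hJJ z‖ ≤ ‖z‖ * (‖(1 : A)‖ + ‖J‖) := by
  rw [Complex.liftAux_apply, Algebra.algebraMap_eq_smul_one, mul_add]
  refine (norm_add_le _ _).trans (add_le_add ?_ ?_) <;> rw [norm_smul]
  · exact mul_le_mul_of_nonneg_right (Complex.abs_re_le_norm z) (norm_nonneg _)
  · exact mul_le_mul_of_nonneg_right (Complex.abs_im_le_norm z) (norm_nonneg _)

/-- If powers of a product tend to zero, then a left ideal that contains `1 - x` is everything. -/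
theorem Ideal.eq_top_of_one_sub_mem_of_tendsto {A : Type*} [NormedRing A] [CompleteSpace A]
    (L : Ideal A) {x : A} (h : 1 - x ∈ L)
    (hx : Filter.Tendsto (fun k : ℕ => x ^ k) Filter.atTop (nhds 0)) : L = ⊤ := by
  -- The element 1 - x^k is a left multiple of 1 - x, and it is a unit once ‖x^k‖ < 1.
  obtain ⟨k, hk⟩ := ((tendsto_zero_iff_norm_tendsto_zero.1 hx).eventually_lt_const
    zero_lt_one).exists
  refine L.eq_top_of_norm_lt_one (x := 1 - x ^ k) ?_ (by simpa using hk)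
  rw [← geom_sum_mul_neg]
  exact L.mul_mem_left _ h

/-- The bound `norm_liftAux_le` is applied to z^k at once, so its constant enters only once and
|z|^k wins. This excludes |z| ≠ 1 in `exists_left_inverse`. -/
theorem tendsto_liftAux_mul_pow {U J : A} (hJ : ∀ x, Commute J x) (hJJ : J * J = -1) {c : ℝ}
    (hU : ∀ k : ℕ, ‖U ^ k‖ ≤ c) {z : ℂ} (hz : ‖z‖ < 1) :
    Filter.Tendsto (fun k : ℕ => (Complex.liftAux J hJJ z * U) ^ k) Filter.atTop (nhds 0) := by
  have h0 : Filter.Tendsto (fun k : ℕ => ‖z‖ ^ k * ((‖(1 : A)‖ + ‖J‖) * c)) Filter.atTop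
      (nhds 0) := by
    simpa using (tendsto_pow_atTop_nhds_zero_of_lt_one (norm_nonneg z) hz).mul_const
      ((‖(1 : A)‖ + ‖J‖) * c)
  refine squeeze_zero_norm (fun k => ?_) h0
  rw [(commute_liftAux hJ hJJ z U).mul_pow, ← map_pow, ← mul_assoc]
  refine (norm_mul_le _ _).trans (mul_le_mul ?_ (hU k) (norm_nonneg _) (by positivity))
  simpa [norm_pow] using norm_liftAux_le hJJ (z ^ k)

/-- Let `U` be a central element of a real Banach algebra, with power-bounded inverse and power
bounded itself, and let `J` be a central square root of `-1`. If `a` is left invertible modulo the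
closed ideal generated by `U - z` for each `z` on the unit circle, then it is left invertible. -/
theorem exists_left_inverse [CompleteSpace A] {U U' J : A} (hU : ∀ x, Commute U x)
    (hJ : ∀ x, Commute J x) (hJJ : J * J = -1) (hUU' : U' * U = 1) {c : ℝ}
    (hc : ∀ k : ℕ, ‖U ^ k‖ ≤ c) (hc' : ∀ k : ℕ, ‖U' ^ k‖ ≤ c) {a : A}
    (ha : ∀ z : Circle, ∃ r, r * a - 1 ∈
      closure (Set.range fun d => d * (U - Complex.liftAux J hJJ z))) :
    ∃ l, l * a = 1 := by
  by_contra! hcon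
  have hne : Ideal.span {a} ≠ ⊤ := fun h => by
    obtain ⟨l, hl⟩ := Ideal.mem_span_singleton'.1 (h ▸ Submodule.mem_top : (1 : A) ∈ Ideal.span {a})
    exact hcon l hl
  obtain ⟨L, hL, haL⟩ := Ideal.exists_le_maximal _ hne
  have haL : a ∈ L := haL (Ideal.mem_span_singleton_self a)
  obtain ⟨z, hz⟩ := exists_sub_mem_of_isMaximal L hU hJ hJJ
  -- Off the circle, L contains 1 - zU⁻¹ (if |z| < 1) or 1 - z⁻¹U (if |z| > 1), and the powers of
  -- the subtracted term tend to zero. On the circle the local inverse applies, since the maximal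
  -- ideal L is closed.
  rcases lt_trichotomy ‖z‖ 1 with h | h | h
  · refine hL.ne_top (L.eq_top_of_one_sub_mem_of_tendsto ?_
      (tendsto_liftAux_mul_pow hJ hJJ hc' h))
    have := L.mul_mem_left U' hz
    rwa [mul_sub, hUU', ← (commute_liftAux hJ hJJ z U').eq] at this
  · obtain ⟨r, hr⟩ := ha ⟨z, mem_sphere_zero_iff_norm.2 h⟩
    have hsub : closure (Set.range fun d => d * (U - Complex.liftAux J hJJ z)) ⊆ L :=
      closure_minimal (by rintro _ ⟨d, rfl⟩; exact L.mul_mem_left d hz) Ideal.IsMaximal.isClosed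
    refine hL.ne_top ((Ideal.eq_top_iff_one L).2 ?_)
    have := L.sub_mem (L.mul_mem_left r haL) (hsub hr)
    simpa using this
  · have hz0 : z ≠ 0 := norm_pos_iff.1 (one_pos.trans h)
    have h' : ‖z⁻¹‖ < 1 := by rw [norm_inv]; exact inv_lt_one_of_one_lt₀ h
    refine hL.ne_top (L.eq_top_of_one_sub_mem_of_tendsto ?_
      (tendsto_liftAux_mul_pow hJ hJJ hc h'))
    have := L.neg_mem (L.mul_mem_left (Complex.liftAux J hJJ z⁻¹) hz)
    rwa [mul_sub, ← map_mul, inv_mul_cancel₀ hz0, map_one, neg_sub] at this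

/-- The two-sided version of `exists_left_inverse`. -/
theorem isUnit_of_forall_circle [CompleteSpace A] {U U' J : A} (hU : ∀ x, Commute U x)
    (hJ : ∀ x, Commute J x) (hJJ : J * J = -1) (hUU' : U' * U = 1) {c : ℝ}
    (hc : ∀ k : ℕ, ‖U ^ k‖ ≤ c) (hc' : ∀ k : ℕ, ‖U' ^ k‖ ≤ c) {a : A}
    (ha : ∀ z : Circle, ∃ r,
      r * a - 1 ∈ closure (Set.range fun d => d * (U - Complex.liftAux J hJJ z)) ∧
      a * r - 1 ∈ closure (Set.range fun d => d * (U - Complex.liftAux J hJJ z))) :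
    IsUnit a := by
  obtain ⟨l, hl⟩ := exists_left_inverse hU hJ hJJ hUU' hc hc' fun z =>
    (ha z).imp fun r hr => hr.1
  have hcomm : ∀ {y : A}, (∀ x, Commute y x) → ∀ x : Aᵐᵒᵖ, Commute (MulOpposite.op y) x :=
    fun {y} hy x => by
      rw [← MulOpposite.op_unop x]
      exact (hy _).op
  have hJJ' : MulOpposite.op J * MulOpposite.op J = -1 := by
    rw [← MulOpposite.op_mul, hJJ, MulOpposite.op_neg, MulOpposite.op_one]
  obtain ⟨r, hr⟩ := exists_left_inverse (A := Aᵐᵒᵖ) (U := .op U) (U' := .op U') (J := .op J)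
    (a := .op a) (c := c) (hcomm hU) (hcomm hJ) hJJ'
    (by rw [← MulOpposite.op_mul, (hU U').eq, hUU', MulOpposite.op_one])
    (fun k => by rw [← MulOpposite.op_pow]; exact hc k)
    (fun k => by rw [← MulOpposite.op_pow]; exact hc' k) fun z => by
      obtain ⟨r, -, hr⟩ := ha z
      refine ⟨.op r, ?_⟩
      -- As U - z is central, its left multiples are also its right multiples, so the closed ideal
      -- is the same in the opposite algebra.
      have hmaps : Set.MapsTo MulOpposite.op
          (Set.range fun d => d * (U - Complex.liftAux J hJJ z))
          (Set.range fun d => d * (MulOpposite.op U - Complex.liftAux (.op J) hJJ' z)) := by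
        rintro _ ⟨d, rfl⟩
        refine ⟨.op d, ?_⟩
        have h1 : MulOpposite.op U - Complex.liftAux (.op J) hJJ' z =
            .op (U - Complex.liftAux J hJJ z) := by
          rw [Complex.liftAux_apply, Complex.liftAux_apply]
          simp
        change MulOpposite.op d * (MulOpposite.op U - Complex.liftAux (.op J) hJJ' z) = _
        rw [h1, ← MulOpposite.op_mul, ((hU d).sub_left (commute_liftAux hJ hJJ z d)).eq]
      exact hmaps.closure MulOpposite.continuous_op hr
  have hr' : a * r.unop = 1 := congrArg MulOpposite.unop hr
  have hlr : l = r.unop := left_inv_eq_right_inv hl hr'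
  exact ⟨⟨a, l, hlr ▸ hr', hl⟩, rfl⟩

end Ideals

/-! ### Scalars and coordinates on complexifications -/

namespace Cplx

theorem ext {E : Type*} {x y : Cplx E} (h₁ : x.fst = y.fst) (h₂ : x.snd = y.snd) : x = y :=
  (WithLp.equiv 2 (E × E)).injective (Prod.ext h₁ h₂)

theorem norm_le_add {E : Type*} [NormedAddCommGroup E] (x : Cplx E) : ‖x‖ ≤ ‖x.fst‖ + ‖x.snd‖ := by
  refine abs_le_of_sq_le_sq' ?_ (by positivity) |>.2
  rw [WithLp.prod_norm_sq_eq_of_L2]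
  nlinarith [norm_nonneg x.fst, norm_nonneg x.snd]

variable {E F G : Type*} [NormedAddCommGroup E] [NormedSpace ℝ E] [NormedAddCommGroup F]
  [NormedSpace ℝ F] [NormedAddCommGroup G] [NormedSpace ℝ G]

@[simp] theorem map_fst (T : E →L[ℝ] F) (x : Cplx E) : (map T x).fst = T x.fst := rfl

@[simp] theorem map_snd (T : E →L[ℝ] F) (x : Cplx E) : (map T x).snd = T x.snd := rfl

/-- Multiplication by the imaginary unit. -/
def imul : Cplx E →L[ℝ] Cplx E :=
  ((WithLp.prodContinuousLinearEquiv 2 ℝ E E).symm : E × E →L[ℝ] Cplx E).comp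
    (((-ContinuousLinearMap.snd ℝ E E).prod (ContinuousLinearMap.fst ℝ E E)).comp
      (WithLp.prodContinuousLinearEquiv 2 ℝ E E : Cplx E →L[ℝ] E × E))

theorem imul_mul_imul : (imul : Cplx E →L[ℝ] Cplx E) * imul = -1 :=
  ContinuousLinearMap.ext fun _ => Cplx.ext rfl rfl

/-- Multiplication by complex numbers, as an algebra homomorphism. -/
def scalar : ℂ →ₐ[ℝ] (Cplx E →L[ℝ] Cplx E) := Complex.liftAux imul imul_mul_imul

theorem scalar_apply (z : ℂ) (x : Cplx E) : scalar z x = cmul z x := by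
  rw [scalar, Complex.liftAux_apply, Algebra.algebraMap_eq_smul_one]
  refine Cplx.ext ?_ ?_
  · change z.re • x.fst + z.im • (-x.snd) = _
    rw [smul_neg, ← sub_eq_add_neg]
    rfl
  · exact add_comm _ _

theorem map_scalar (T : E →L[ℝ] F) (z : ℂ) (x : Cplx E) :
    map T (scalar z x) = scalar z (map T x) := by
  rw [scalar_apply, scalar_apply]
  exact Cplx.ext (by simp [cmul]) (by simp [cmul])

/-- The constant is crude: two components with two terms each, every term at most ‖x‖. Only
uniformity in z matters later. -/
theorem norm_scalar_apply_le (z : Circle) (x : Cplx E) : ‖scalar (z : ℂ) x‖ ≤ 4 * ‖x‖ := by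
  have h1 : |(z : ℂ).re| ≤ 1 := (Complex.abs_re_le_norm _).trans (Circle.norm_coe _).le
  have h2 : |(z : ℂ).im| ≤ 1 := (Complex.abs_im_le_norm _).trans (Circle.norm_coe _).le
  have key : ∀ (t : ℝ) (y : E), |t| ≤ 1 → ‖y‖ ≤ ‖x‖ → ‖t • y‖ ≤ ‖x‖ := fun t y ht hy => by
    rw [norm_smul, Real.norm_eq_abs]
    exact (mul_le_of_le_one_left (norm_nonneg y) ht).trans hy
  have h3 := WithLp.norm_fst_le (p := 2) _ x
  have h4 := WithLp.norm_snd_le (p := 2) _ x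
  rw [scalar_apply]
  refine (norm_le_add _).trans ?_
  have h5 := norm_sub_le ((z : ℂ).re • x.fst) ((z : ℂ).im • x.snd)
  have h6 := norm_add_le ((z : ℂ).im • x.fst) ((z : ℂ).re • x.snd)
  simp only [cmul, WithLp.toLp_fst, WithLp.toLp_snd]
  linarith [key _ _ h1 h3, key _ _ h2 h4, key _ _ h2 h3, key _ _ h1 h4]

theorem scalar_mul_apply (w z : ℂ) (x : Cplx E) : scalar (w * z) x = scalar w (scalar z x) := by
  rw [map_mul]; rfl

theorem scalar_one_apply (x : Cplx E) : scalar 1 x = x := by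
  rw [map_one]; rfl

end Cplx

/-! ### Complexified bounded sequences -/

/-- Complexified bounded sequences, as a type of its own. -/
def CSeq (Y : Type*) [NormedAddCommGroup Y] : Type _ := Cplx (LInfty Y)

instance {Y : Type*} [NormedAddCommGroup Y] : NormedAddCommGroup (CSeq Y) :=
  inferInstanceAs (NormedAddCommGroup (Cplx (LInfty Y)))

instance {Y : Type*} [NormedAddCommGroup Y] [NormedSpace ℝ Y] : NormedSpace ℝ (CSeq Y) :=
  inferInstanceAs (NormedSpace ℝ (Cplx (LInfty Y)))

instance {Y : Type*} [NormedAddCommGroup Y] [CompleteSpace Y] : CompleteSpace (CSeq Y) :=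
  inferInstanceAs (CompleteSpace (Cplx (LInfty Y)))

namespace CSeq

open Cplx

variable {Y : Type*} [NormedAddCommGroup Y] [NormedSpace ℝ Y]

variable (Y) in
/-- The identification of `CSeq Y` with the complexification of the bounded sequences. -/
def equiv : CSeq Y ≃L[ℝ] Cplx (LInfty Y) := ContinuousLinearEquiv.refl ℝ (Cplx (LInfty Y))

theorem norm_equiv (x : CSeq Y) : ‖equiv Y x‖ = ‖x‖ := rfl

/-- An operator on complexified bounded sequences. -/
def lift (T : Cplx (LInfty Y) →L[ℝ] Cplx (LInfty Y)) : CSeq Y →L[ℝ] CSeq Y :=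
  ((equiv Y).symm : Cplx (LInfty Y) →L[ℝ] CSeq Y).comp
    (T.comp (equiv Y : CSeq Y →L[ℝ] Cplx (LInfty Y)))

theorem mul_apply (S T : CSeq Y →L[ℝ] CSeq Y) (x : CSeq Y) : (S * T) x = S (T x) := rfl

theorem apply_comm {S T : CSeq Y →L[ℝ] CSeq Y} (h : Commute S T) (x : CSeq Y) :
    S (T x) = T (S x) := by
  rw [← mul_apply, h.eq, mul_apply]

variable (Y) in
/-- Multiplication by the imaginary unit. -/
def cimul : CSeq Y →L[ℝ] CSeq Y := lift imul

variable (Y) in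
theorem cimul_mul_cimul : cimul Y * cimul Y = -1 :=
  ContinuousLinearMap.ext fun x => (equiv Y).injective
    (congrArg (fun T : Cplx (LInfty Y) →L[ℝ] Cplx (LInfty Y) => T (equiv Y x)) imul_mul_imul)

/-- Multiplication by complex numbers, as an algebra homomorphism. -/
def cscalar : ℂ →ₐ[ℝ] (CSeq Y →L[ℝ] CSeq Y) := Complex.liftAux (cimul Y) (cimul_mul_cimul Y)

theorem equiv_cscalar (z : ℂ) (x : CSeq Y) : equiv Y (cscalar z x) = scalar z (equiv Y x) := by
  rw [cscalar, scalar, Complex.liftAux_apply, Complex.liftAux_apply,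
    Algebra.algebraMap_eq_smul_one, Algebra.algebraMap_eq_smul_one]
  rfl

theorem norm_cscalar_apply_le (z : Circle) (x : CSeq Y) : ‖cscalar (z : ℂ) x‖ ≤ 4 * ‖x‖ := by
  rw [← norm_equiv, equiv_cscalar, ← norm_equiv x]
  exact norm_scalar_apply_le z _

theorem cscalar_mul_apply (w z : ℂ) (x : CSeq Y) : cscalar (w * z) x = cscalar w (cscalar z x) := by
  rw [map_mul, mul_apply]

theorem cscalar_one_apply (x : CSeq Y) : cscalar 1 x = x := by
  rw [map_one]; rfl

/-- The `k`-th term of a complexified bounded sequence. -/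
def coord (k : ℤ) : CSeq Y →L[ℝ] Cplx Y :=
  (Cplx.map (lp.evalCLM ℝ (fun _ : ℤ => Y) ∞ k)).comp (equiv Y : CSeq Y →L[ℝ] Cplx (LInfty Y))

/-- The extension of an operator on bounded sequences to complexified bounded sequences. -/
def complexify (B : LInfty Y →L[ℝ] LInfty Y) : CSeq Y →L[ℝ] CSeq Y := lift (Cplx.map B)

/-- The shift on complexified bounded sequences. -/
def cshift (m : ℤ) : CSeq Y →L[ℝ] CSeq Y := complexify (shift m)

theorem coord_cshift (k m : ℤ) (x : CSeq Y) : coord k (cshift m x) = coord (m + k) x :=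
  rfl

theorem coord_cscalar (k : ℤ) (z : ℂ) (x : CSeq Y) :
    coord k (cscalar z x) = scalar z (coord k x) := by
  change Cplx.map _ (equiv Y (cscalar z x)) = _
  rw [equiv_cscalar, map_scalar]
  rfl

theorem equiv_complexify (T : LInfty Y →L[ℝ] LInfty Y) (x : CSeq Y) :
    equiv Y (complexify T x) = Cplx.map T (equiv Y x) := rfl

theorem complexify_cscalar (T : LInfty Y →L[ℝ] LInfty Y) (z : ℂ) (x : CSeq Y) :
    complexify T (cscalar z x) = cscalar z (complexify T x) :=
  (equiv Y).injective (by
    rw [equiv_complexify, equiv_cscalar, map_scalar, equiv_cscalar, equiv_complexify])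

theorem cshift_cscalar (m : ℤ) (z : ℂ) (x : CSeq Y) :
    cshift m (cscalar z x) = cscalar z (cshift m x) := complexify_cscalar _ z x

theorem ext_coord {x y : CSeq Y} (h : ∀ k, coord k x = coord k y) : x = y :=
  (equiv Y).injective (Cplx.ext (lp.ext (funext fun k => congrArg WithLp.fst (h k)))
    (lp.ext (funext fun k => congrArg WithLp.snd (h k))))

theorem norm_le_of_coord_le {x : CSeq Y} {c : ℝ} (hc : 0 ≤ c)
    (h : ∀ k, ‖coord k x‖ ≤ c) : ‖x‖ ≤ 2 * c := by
  have h1 : ‖(equiv Y x).fst‖ ≤ c :=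
    lp.norm_le_of_forall_le hc fun k => (WithLp.norm_fst_le (p := 2) _ (coord k x)).trans (h k)
  have h2 : ‖(equiv Y x).snd‖ ≤ c :=
    lp.norm_le_of_forall_le hc fun k => (WithLp.norm_snd_le (p := 2) _ (coord k x)).trans (h k)
  rw [← norm_equiv]
  linarith [norm_le_add (equiv Y x)]

theorem norm_coord_le (k : ℤ) (x : CSeq Y) : ‖coord k x‖ ≤ 2 * ‖x‖ := by
  have h1 : ‖(coord k x).fst‖ ≤ ‖x‖ :=
    (lp.norm_apply_le_norm ENNReal.top_ne_zero (equiv Y x).fst k).trans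
      (WithLp.norm_fst_le _ (equiv Y x))
  have h2 : ‖(coord k x).snd‖ ≤ ‖x‖ :=
    (lp.norm_apply_le_norm ENNReal.top_ne_zero (equiv Y x).snd k).trans
      (WithLp.norm_snd_le _ (equiv Y x))
  linarith [norm_le_add (coord k x)]

theorem norm_cshift_le (m : ℤ) (x : CSeq Y) : ‖cshift m x‖ ≤ 4 * ‖x‖ := by
  refine (norm_le_of_coord_le (c := 2 * ‖x‖) (by positivity) fun k => ?_).trans (by linarith)
  rw [coord_cshift]
  exact norm_coord_le _ x

theorem cshift_mul_cshift (l m : ℤ) :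
    (cshift l : CSeq Y →L[ℝ] CSeq Y) * cshift m = cshift (l + m) := by
  refine ContinuousLinearMap.ext fun x => ext_coord fun k => ?_
  change coord k (cshift l (cshift m x)) = _
  rw [coord_cshift, coord_cshift, coord_cshift]
  congr 2
  ring

theorem cshift_zero : (cshift 0 : CSeq Y →L[ℝ] CSeq Y) = 1 := by
  refine ContinuousLinearMap.ext fun x => ext_coord fun k => ?_
  rw [coord_cshift, zero_add]
  rfl

theorem cshift_pow (m : ℤ) (k : ℕ) :
    (cshift m : CSeq Y →L[ℝ] CSeq Y) ^ k = cshift (m * k) := by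
  induction k with
  | zero => simp [cshift_zero]
  | succ k ih =>
    rw [pow_succ, ih, cshift_mul_cshift]
    congr 1
    push_cast
    ring

/-- An operator into the complexified bounded sequences, given by its uniformly bounded
coordinates. -/
def ofCoords {X : Type*} [NormedAddCommGroup X] [NormedSpace ℝ X] (φ : ℤ → X →L[ℝ] Cplx Y) (c : ℝ)
    (h : ∀ k x, ‖φ k x‖ ≤ c * ‖x‖) : X →L[ℝ] CSeq Y :=
  ((equiv Y).symm : Cplx (LInfty Y) →L[ℝ] CSeq Y).comp <|
  ((WithLp.prodContinuousLinearEquiv 2 ℝ (LInfty Y) (LInfty Y)).symm :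
      LInfty Y × LInfty Y →L[ℝ] Cplx (LInfty Y)).comp
    ((LinearMap.mkContinuous (σ := RingHom.id ℝ)
      { toFun := fun x => LInfty.mk (fun k => (φ k x).fst) (c * ‖x‖)
          fun k => (WithLp.norm_fst_le _ (φ k x)).trans (h k x)
        map_add' := fun x y => lp.ext (funext fun k => congrArg WithLp.fst (map_add (φ k) x y))
        map_smul' := fun (r : ℝ) x =>
          lp.ext (funext fun k => congrArg WithLp.fst (map_smul (φ k) r x)) } c
      fun x => lp.norm_le_of_forall_le ((norm_nonneg _).trans (h 0 x))
        fun k => (WithLp.norm_fst_le _ (φ k x)).trans (h k x)).prod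
    (LinearMap.mkContinuous (σ := RingHom.id ℝ)
      { toFun := fun x => LInfty.mk (fun k => (φ k x).snd) (c * ‖x‖)
          fun k => (WithLp.norm_snd_le _ (φ k x)).trans (h k x)
        map_add' := fun x y => lp.ext (funext fun k => congrArg WithLp.snd (map_add (φ k) x y))
        map_smul' := fun (r : ℝ) x =>
          lp.ext (funext fun k => congrArg WithLp.snd (map_smul (φ k) r x)) } c
      fun x => lp.norm_le_of_forall_le ((norm_nonneg _).trans (h 0 x))
        fun k => (WithLp.norm_snd_le _ (φ k x)).trans (h k x)))

end CSeq

/-! ### Quasi-periodic sequences -/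

section Quasiperiodic

open Cplx CSeq

variable {Y : Type*} [NormedAddCommGroup Y] [NormedSpace ℝ Y]

theorem scalar_inv_scalar {E : Type*} [NormedAddCommGroup E] [NormedSpace ℝ E] (z : Circle)
    (x : Cplx E) : scalar ((z⁻¹ : Circle) : ℂ) (scalar (z : ℂ) x) = x := by
  rw [← scalar_mul_apply, ← Circle.coe_mul, inv_mul_cancel, Circle.coe_one, scalar_one_apply]

variable (n : ℕ)

/-- The `q`-th block of length `n` of a sequence. -/
def block (q : ℤ) : CSeq Y →L[ℝ] (Fin n → Cplx Y) :=
  ContinuousLinearMap.pi fun j => coord ((n : ℤ) * q + (j : ℕ))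

/-- Multiplication of all components by a complex number. -/
def scalarPi (z : ℂ) : (Fin n → Cplx Y) →L[ℝ] (Fin n → Cplx Y) :=
  ContinuousLinearMap.pi fun j => (scalar z).comp (ContinuousLinearMap.proj j)

/-- Multiplication of the `j`-th component by `M ^ j`. -/
def twist (M : Circle) : (Fin n → Cplx Y) →L[ℝ] (Fin n → Cplx Y) :=
  ContinuousLinearMap.pi fun j =>
    (scalar ((M ^ (j : ℕ) : Circle) : ℂ)).comp (ContinuousLinearMap.proj j)

variable {n}

theorem block_apply (q : ℤ) (x : CSeq Y) (j : Fin n) :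
    block n q x j = coord ((n : ℤ) * q + (j : ℕ)) x := rfl

theorem scalarPi_apply (z : ℂ) (x : Fin n → Cplx Y) (j : Fin n) :
    scalarPi n z x j = scalar z (x j) := rfl

theorem block_cscalar (q : ℤ) (z : ℂ) (x : CSeq Y) :
    block n q (cscalar z x) = scalarPi n z (block n q x) :=
  funext fun _ => coord_cscalar _ z x

theorem twist_inv_twist (M : Circle) (x : Fin n → Cplx Y) : twist n M⁻¹ (twist n M x) = x := by
  funext j
  change scalar ((M⁻¹ ^ (j : ℕ) : Circle) : ℂ) (scalar ((M ^ (j : ℕ) : Circle) : ℂ) (x j)) = x j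
  rw [inv_pow, scalar_inv_scalar]

theorem twist_twist_inv (M : Circle) (x : Fin n → Cplx Y) : twist n M (twist n M⁻¹ x) = x := by
  simpa using twist_inv_twist M⁻¹ x

variable (n) [NeZero n]

theorem coe_residue (k : ℤ) : ((residue n k : ℕ) : ℤ) = k % n :=
  Int.toNat_of_nonneg (Int.emod_nonneg k (by exact_mod_cast NeZero.ne n))

theorem mul_ediv_add_residue (k : ℤ) : (n : ℤ) * (k / n) + (residue n k : ℕ) = k := by
  rw [coe_residue]
  exact Int.mul_ediv_add_emod k n

theorem mul_add_coe_ediv (q : ℤ) (j : Fin n) : ((n : ℤ) * q + (j : ℕ)) / n = q := by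
  have hn : (n : ℤ) ≠ 0 := by exact_mod_cast NeZero.ne n
  rw [Int.add_comm, Int.add_mul_ediv_left _ _ hn,
    Int.ediv_eq_zero_of_lt (by positivity) (by exact_mod_cast j.2), zero_add]

theorem residue_mul_add_coe (q : ℤ) (j : Fin n) : residue n ((n : ℤ) * q + (j : ℕ)) = j := by
  refine Fin.ext ?_
  have h : ((residue n ((n : ℤ) * q + (j : ℕ)) : ℕ) : ℤ) = (j : ℕ) := by
    rw [coe_residue, Int.add_comm, Int.add_mul_emod_self_left]
    exact Int.emod_eq_of_lt (by positivity) (by exact_mod_cast j.2)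
  exact_mod_cast h

theorem add_ediv_period (k : ℤ) : ((n : ℤ) + k) / n = k / n + 1 := by
  have hn : (n : ℤ) ≠ 0 := by exact_mod_cast NeZero.ne n
  rw [Int.add_comm, Int.add_ediv_of_dvd_right (dvd_refl _), Int.ediv_self hn]

theorem residue_add_period (k : ℤ) : residue n ((n : ℤ) + k) = residue n k := by
  refine Fin.ext ?_
  have h : ((residue n ((n : ℤ) + k) : ℕ) : ℤ) = (residue n k : ℕ) := by
    rw [coe_residue, coe_residue, Int.add_emod_left]
  exact_mod_cast h

/-- The extension of `x_0, …, x_{n-1}` to a sequence with `x_{n+k} = z x_k`. -/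
def quasiExt (z : Circle) : (Fin n → Cplx Y) →L[ℝ] CSeq Y :=
  ofCoords (fun k => (scalar ((z ^ (k / n) : Circle) : ℂ)).comp
    (ContinuousLinearMap.proj (residue n k))) 4 fun k x =>
      (norm_scalar_apply_le _ _).trans (by gcongr; exact norm_le_pi_norm x _)

variable {n}

theorem coord_quasiExt (z : Circle) (k : ℤ) (x : Fin n → Cplx Y) :
    coord k (quasiExt n z x) = scalar ((z ^ (k / n) : Circle) : ℂ) (x (residue n k)) := rfl

theorem block_quasiExt (z : Circle) (q : ℤ) (x : Fin n → Cplx Y) :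
    block n q (quasiExt n z x) = scalarPi n ((z ^ q : Circle) : ℂ) x := by
  funext j
  rw [block_apply, coord_quasiExt, mul_add_coe_ediv, residue_mul_add_coe, scalarPi_apply]

theorem block_zero_quasiExt (z : Circle) (x : Fin n → Cplx Y) :
    block n 0 (quasiExt n z x) = x := by
  rw [block_quasiExt]
  funext j
  rw [scalarPi_apply, zpow_zero, Circle.coe_one, scalar_one_apply]

theorem quasiExt_scalarPi (z : Circle) (w : ℂ) (x : Fin n → Cplx Y) :
    quasiExt n z (scalarPi n w x) = cscalar w (quasiExt n z x) := by
  refine ext_coord fun k => ?_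
  rw [coord_cscalar, coord_quasiExt, coord_quasiExt, scalarPi_apply, ← scalar_mul_apply, mul_comm,
    scalar_mul_apply]

theorem cshift_quasiExt (z : Circle) (x : Fin n → Cplx Y) :
    cshift n (quasiExt n z x) = cscalar (z : ℂ) (quasiExt n z x) := by
  refine ext_coord fun k => ?_
  rw [coord_cshift, coord_cscalar, coord_quasiExt, coord_quasiExt, add_ediv_period,
    residue_add_period, zpow_add_one, mul_comm, Circle.coe_mul, scalar_mul_apply]

theorem cscalar_cscalar_inv (z : Circle) (x : CSeq Y) :
    cscalar (z : ℂ) (cscalar ((z⁻¹ : Circle) : ℂ) x) = x := by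
  rw [← cscalar_mul_apply, ← Circle.coe_mul, mul_inv_cancel, Circle.coe_one, cscalar_one_apply]

/-- A property that is invariant under translation of the index by `n` in both directions holds
everywhere if it holds on `0, …, n - 1`. -/
theorem forall_int_of_period {P : ℤ → Prop} (h0 : ∀ j : Fin n, P (j : ℕ))
    (h : ∀ k, P k ↔ P ((n : ℤ) + k)) (k : ℤ) : P k := by
  have key : ∀ q : ℤ, P ((n : ℤ) * q + (residue n k : ℕ)) := fun q => by
    induction q using Int.induction_on with
    | zero => simpa using h0 (residue n k)
    | succ i ih =>
      rw [h] at ih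
      convert ih using 1
      ring
    | pred i ih =>
      rw [h]
      convert ih using 1
      ring
  exact mul_ediv_add_residue n k ▸ key (k / n)

/-- An eigenvector of S(n) is determined by its initial block, so the eigenspace is parametrized by
n-tuples. -/
theorem eq_quasiExt {z : Circle} {y : CSeq Y} (h : cshift n y = cscalar (z : ℂ) y) :
    y = quasiExt n z (block n 0 y) := by
  refine ext_coord (forall_int_of_period (n := n) (fun j => ?_) fun k => ?_)
  · have := congrFun (block_zero_quasiExt z (block n 0 y)) j
    rw [block_apply, block_apply, mul_zero, zero_add] at this
    exact this.symm
  · rw [← coord_cshift, ← coord_cshift, h, cshift_quasiExt, coord_cscalar, coord_cscalar]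
    exact ⟨fun h => by rw [h], fun h => by
      simpa only [scalar_inv_scalar] using congrArg (scalar ((z⁻¹ : Circle) : ℂ)) h⟩

theorem apply_quasiExt {T : CSeq Y →L[ℝ] CSeq Y} (hT : Commute T (cshift n))
    (hTs : ∀ (w : ℂ) x, T (cscalar w x) = cscalar w (T x)) (z : Circle) (x : Fin n → Cplx Y) :
    T (quasiExt n z x) = quasiExt n z (block n 0 (T (quasiExt n z x))) := by
  refine eq_quasiExt ?_
  rw [← apply_comm hT, cshift_quasiExt, hTs]

/-- With k = nq + r, the factor M^k splits as (M^n)^q M^r; the first factor is quasi-periodicity,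
the second is the twist. -/
theorem diagMul_eq (M : Circle) (x : Fin n → Cplx Y) :
    (equiv Y).symm (diagMul n M x) = quasiExt n (M ^ n) (twist n M x) := by
  refine ext_coord fun k => ?_
  have h1 : coord k ((equiv Y).symm (diagMul n M x)) =
      scalar ((M ^ k : Circle) : ℂ) (x (residue n k)) := by
    rw [scalar_apply]
    rfl
  have h2 : twist n M x (residue n k) =
      scalar ((M ^ (residue n k : ℕ) : Circle) : ℂ) (x (residue n k)) := rfl
  rw [h1, coord_quasiExt, h2, ← scalar_mul_apply, ← Circle.coe_mul, ← zpow_natCast M n,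
    ← zpow_mul, ← zpow_natCast, ← zpow_add, mul_ediv_add_residue]

theorem fourierTransform_apply (B : LInfty Y →L[ℝ] LInfty Y) (M : Circle) (x : Fin n → Cplx Y) :
    fourierTransform n B M x =
      block n 0 (complexify B (quasiExt n (M ^ n) (twist n M x))) := by
  rw [← diagMul_eq]
  funext j
  rw [block_apply, mul_zero, zero_add]
  rfl

end Quasiperiodic

/-! ### Cesàro means -/

/-- The Cesàro mean of `1, v, …, v ^ N`. -/
def cesaro {A : Type*} [Ring A] [Algebra ℝ A] (v : A) (N : ℕ) : A :=
  ((N : ℝ) + 1)⁻¹ • ∑ j ∈ Finset.range (N + 1), v ^ j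

section Cesaro

variable {A : Type*} [Ring A] [Algebra ℝ A]

/-- Telescoping. For power-bounded v the right side is O(1/N), so the means are asymptotically fixed
by v. -/
theorem sub_one_mul_cesaro (v : A) (N : ℕ) :
    (v - 1) * cesaro v N = ((N : ℝ) + 1)⁻¹ • (v ^ (N + 1) - 1) := by
  rw [cesaro, mul_smul_comm, mul_geom_sum]

/-- Each 1 - v^j is a multiple of v - 1, hence so is their average. -/
theorem exists_one_sub_cesaro_eq_mul (v : A) (N : ℕ) : ∃ d, 1 - cesaro v N = d * (v - 1) := by
  refine ⟨-(((N : ℝ) + 1)⁻¹ • ∑ j ∈ Finset.range (N + 1), ∑ i ∈ Finset.range j, v ^ i), ?_⟩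
  rw [neg_mul, smul_mul_assoc, Finset.sum_mul]
  simp only [geom_sum_mul]
  rw [Finset.sum_sub_distrib, smul_sub, cesaro, Finset.sum_const, Finset.card_range, neg_sub,
    ← Nat.cast_smul_eq_nsmul ℝ, smul_smul, Nat.cast_add, Nat.cast_one,
    inv_mul_cancel₀ (by positivity), one_smul]

theorem commute_cesaro {a v : A} (h : Commute a v) (N : ℕ) :
    Commute a (cesaro v N) :=
  (Commute.sum_right _ _ _ fun j _ => h.pow_right j).smul_right _

end Cesaro

/-- An element lies in the closed ideal generated by `U - z` if its products with Cesàro means of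
the powers of `z⁻¹ U` are arbitrarily small. -/
theorem mem_closure_of_mul_cesaro {A : Type*} [NormedRing A] [NormedAlgebra ℝ A] {U J C : A}
    (hJJ : J * J = -1) (z : Circle)
    (h : ∀ ε > 0, ∃ N, ‖C * cesaro (Complex.liftAux J hJJ ((z⁻¹ : Circle) : ℂ) * U) N‖ ≤ ε) :
    C ∈ closure (Set.range fun d => d * (U - Complex.liftAux J hJJ z)) := by
  refine Metric.mem_closure_range_iff.2 fun ε hε => ?_
  obtain ⟨N, hN⟩ := h (ε / 2) (half_pos hε)
  set v := Complex.liftAux J hJJ ((z⁻¹ : Circle) : ℂ) * U with hv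
  obtain ⟨d, hd⟩ := exists_one_sub_cesaro_eq_mul v N
  have hv1 : v - 1 = Complex.liftAux J hJJ ((z⁻¹ : Circle) : ℂ) *
      (U - Complex.liftAux J hJJ z) := by
    rw [mul_sub, ← map_mul, ← Circle.coe_mul, inv_mul_cancel, Circle.coe_one, map_one]
  refine ⟨C * d * Complex.liftAux J hJJ ((z⁻¹ : Circle) : ℂ), ?_⟩
  rw [mul_assoc, ← hv1, mul_assoc, ← hd, dist_eq_norm, mul_sub, mul_one, sub_sub_cancel]
  linarith

/-! ### Operators that preserve bounded coordinatewise null sequences -/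

section PreservesNull

open Cplx CSeq Filter Topology

variable {Y : Type*} [NormedAddCommGroup Y] [NormedSpace ℝ Y]

/-- `T` maps bounded sequences that tend to zero coordinatewise to sequences that tend to zero
coordinatewise. -/
def PreservesNull (T : CSeq Y →L[ℝ] CSeq Y) : Prop :=
  ∀ (x : ℕ → CSeq Y), (∃ c : ℝ, ∀ m, ‖x m‖ ≤ c) →
    (∀ k, Tendsto (fun m => coord k (x m)) atTop (𝓝 0)) →
      ∀ k, Tendsto (fun m => coord k (T (x m))) atTop (𝓝 0)

theorem PreservesNull.mul {S T : CSeq Y →L[ℝ] CSeq Y} (hS : PreservesNull S)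
    (hT : PreservesNull T) : PreservesNull (S * T) := fun x ⟨c, hc⟩ hx =>
  hS (fun m => T (x m)) ⟨‖T‖ * c, fun m => T.le_opNorm_of_le (hc m)⟩ (hT x ⟨c, hc⟩ hx)

theorem PreservesNull.sub_one {T : CSeq Y →L[ℝ] CSeq Y}
    (hT : PreservesNull T) : PreservesNull (T - 1) := fun x hc hx k => by
  simpa using (hT x hc hx k).sub (hx k)

/-- A `c`-continuous operator maps bounded `c`-null sequences to `c`-null sequences. -/
theorem CContinuous.tendsto_zero {B : LInfty Y →L[ℝ] LInfty Y} (hB : CContinuous B)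
    {x : ℕ → LInfty Y} (hc : ∃ c : ℝ, ∀ m, ‖x m‖ ≤ c)
    (hx : ∀ k, Tendsto (fun m => x m k) atTop (𝓝 0)) (k : ℤ) :
    Tendsto (fun m => B (x m) k) atTop (𝓝 0) := by
  obtain ⟨c, hc⟩ := hc
  have hhalf : Tendsto (fun m : ℕ => m / 2) atTop atTop :=
    tendsto_atTop_atTop.2 fun b => ⟨2 * b, fun a ha => by omega⟩
  have hodd : Tendsto (fun m : ℕ => 2 * m + 1) atTop atTop :=
    tendsto_atTop_atTop.2 fun b => ⟨b, fun a ha => by omega⟩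
  have heven : Tendsto (fun m : ℕ => 2 * m) atTop atTop :=
    tendsto_atTop_atTop.2 fun b => ⟨b, fun a ha => by omega⟩
  -- c-continuity gives only the existence of a limit. Interleaving the sequence with zeros forces
  -- that limit to be zero along odd indices, hence also along even ones.
  obtain ⟨w, hw⟩ := hB (fun m => if Even m then x (m / 2) else 0) 0
    ⟨c, fun m => by
      split_ifs
      · exact hc _
      · rw [norm_zero]; exact (norm_nonneg _).trans (hc 0)⟩
    fun k => by
      refine squeeze_zero (fun _ => norm_nonneg _) (fun m => ?_)
        (tendsto_zero_iff_norm_tendsto_zero.1 ((hx k).comp hhalf))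
      by_cases hm : Even m <;> simp [hm]
  have hw0 : w k = 0 := by
    simpa [Function.comp_def, tendsto_const_nhds_iff] using (hw k).comp hodd
  rw [tendsto_zero_iff_norm_tendsto_zero]
  simpa [Function.comp_def, hw0] using (hw k).comp heven

theorem tendsto_cplx_zero_iff {E : Type*} [NormedAddCommGroup E] {x : ℕ → Cplx E} :
    Tendsto x atTop (𝓝 0) ↔
      Tendsto (fun m => (x m).fst) atTop (𝓝 0) ∧ Tendsto (fun m => (x m).snd) atTop (𝓝 0) := by
  refine ⟨fun h => ⟨?_, ?_⟩, fun ⟨h1, h2⟩ => ?_⟩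
  · exact squeeze_zero_norm (fun m => WithLp.norm_fst_le _ (x m))
      (tendsto_zero_iff_norm_tendsto_zero.1 h)
  · exact squeeze_zero_norm (fun m => WithLp.norm_snd_le _ (x m))
      (tendsto_zero_iff_norm_tendsto_zero.1 h)
  · refine squeeze_zero_norm (fun m => norm_le_add (x m)) ?_
    simpa using (tendsto_zero_iff_norm_tendsto_zero.1 h1).add
      (tendsto_zero_iff_norm_tendsto_zero.1 h2)

theorem CContinuous.preservesNull_complexify {B : LInfty Y →L[ℝ] LInfty Y} (hB : CContinuous B) :
    PreservesNull (complexify B) := fun x ⟨c, hc⟩ hx k =>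
  tendsto_cplx_zero_iff.2
    ⟨hB.tendsto_zero ⟨c, fun m => (WithLp.norm_fst_le _ (equiv Y (x m))).trans (hc m)⟩
        (fun k => (tendsto_cplx_zero_iff.1 (hx k)).1) k,
      hB.tendsto_zero ⟨c, fun m => (WithLp.norm_snd_le _ (equiv Y (x m))).trans (hc m)⟩
        (fun k => (tendsto_cplx_zero_iff.1 (hx k)).2) k⟩

/-! ### Operators that vanish on quasi-periodic sequences -/

variable {n : ℕ}

theorem commute_cshift_mul {T : CSeq Y →L[ℝ] CSeq Y} {m : ℤ}
    (hT : Commute T (cshift m)) (q : ℤ) : Commute T (cshift (m * q)) := by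
  have hneg : Commute T (cshift (-m)) := by
    have h1 : (cshift m : CSeq Y →L[ℝ] CSeq Y) * cshift (-m) = 1 := by
      rw [cshift_mul_cshift, add_neg_cancel, cshift_zero]
    have h2 : (cshift (-m) : CSeq Y →L[ℝ] CSeq Y) * cshift m = 1 := by
      rw [cshift_mul_cshift, neg_add_cancel, cshift_zero]
    exact Commute.units_inv_right (u := ⟨cshift m, cshift (-m), h1, h2⟩) hT
  obtain ⟨k, rfl | rfl⟩ := q.eq_nat_or_neg
  · rw [← cshift_pow]; exact hT.pow_right k
  · rw [mul_neg, ← neg_mul, ← cshift_pow]; exact hneg.pow_right k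

/-- The rescaled shift `z⁻¹ S(n)`, which fixes the sequences with `x_{n+k} = z x_k`. -/
def rescaledShift (n : ℕ) (z : Circle) : CSeq Y →L[ℝ] CSeq Y :=
  (cscalar ((z⁻¹ : Circle) : ℂ) : CSeq Y →L[ℝ] CSeq Y) * cshift n

theorem commute_cscalar_cshift (w : ℂ) (m : ℤ) :
    Commute (cscalar w : CSeq Y →L[ℝ] CSeq Y) (cshift m) :=
  ContinuousLinearMap.ext fun x => (cshift_cscalar m w x).symm

theorem commute_cshift_cshift (l m : ℤ) : Commute (cshift l : CSeq Y →L[ℝ] CSeq Y) (cshift m) := by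
  rw [commute_iff_eq, cshift_mul_cshift, cshift_mul_cshift, add_comm]

theorem commute_cshift_rescaledShift (m : ℤ) (z : Circle) :
    Commute (cshift m : CSeq Y →L[ℝ] CSeq Y) (rescaledShift n z) :=
  (commute_cscalar_cshift (Y := Y) _ m).symm.mul_right (commute_cshift_cshift m n)

theorem rescaledShift_apply (n : ℕ) (z : Circle) (x : CSeq Y) :
    rescaledShift n z x = cscalar ((z⁻¹ : Circle) : ℂ) (cshift n x) := rfl

theorem norm_rescaledShift_pow_apply_le (z : Circle) (j : ℕ) (x : CSeq Y) :
    ‖(rescaledShift n z ^ j) x‖ ≤ 16 * ‖x‖ := by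
  have h : (rescaledShift n z ^ j : CSeq Y →L[ℝ] CSeq Y) =
      (cscalar ((z⁻¹ ^ j : Circle) : ℂ) : CSeq Y →L[ℝ] CSeq Y) * cshift (n * j) := by
    have h0 := (commute_cscalar_cshift (Y := Y) ((z⁻¹ : Circle) : ℂ) n).mul_pow j
    rw [rescaledShift, h0, cshift_pow, ← map_pow, Circle.coe_pow]
  rw [h, CSeq.mul_apply]
  refine (norm_cscalar_apply_le _ _).trans ?_
  linarith [norm_cshift_le (n * j) x]

variable (n) in
/-- The Cesàro means of the powers of the rescaled shift. -/
def cesaroShift (z : Circle) (N : ℕ) : CSeq Y →L[ℝ] CSeq Y := cesaro (rescaledShift n z) N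

theorem norm_cesaroShift_apply_le (z : Circle) (N : ℕ) (x : CSeq Y) :
    ‖cesaroShift n z N x‖ ≤ 16 * ‖x‖ := by
  have hN : (0 : ℝ) < N + 1 := by positivity
  rw [cesaroShift, cesaro, smul_apply, sum_apply, norm_smul,
    Real.norm_of_nonneg (by positivity), inv_mul_le_iff₀ hN]
  refine (norm_sum_le_of_le _ fun j _ => norm_rescaledShift_pow_apply_le z j x).trans ?_
  simp

theorem norm_rescaledShift_cesaroShift_sub_le (z : Circle) (N : ℕ) (x : CSeq Y) :
    ‖rescaledShift n z (cesaroShift n z N x) - cesaroShift n z N x‖ ≤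
      ((N : ℝ) + 1)⁻¹ * (17 * ‖x‖) := by
  have h : rescaledShift n z (cesaroShift n z N x) - cesaroShift n z N x =
      ((N : ℝ) + 1)⁻¹ • ((rescaledShift n z ^ (N + 1)) x - x) :=
    congrArg (fun T : CSeq Y →L[ℝ] CSeq Y => T x) (sub_one_mul_cesaro (rescaledShift n z) N)
  rw [h, norm_smul, Real.norm_of_nonneg (by positivity)]
  gcongr
  linarith [norm_sub_le ((rescaledShift n z ^ (N + 1)) x) x,
    norm_rescaledShift_pow_apply_le (n := n) z (N + 1) x]

theorem tendsto_map_zero {E F : Type*} [NormedAddCommGroup E] [NormedSpace ℝ E]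
    [NormedAddCommGroup F] [NormedSpace ℝ F] (T : E →L[ℝ] F) {x : ℕ → E}
    (hx : Tendsto x atTop (𝓝 0)) : Tendsto (fun m => T (x m)) atTop (𝓝 0) := by
  have h := (T.continuous.tendsto 0).comp hx
  rwa [map_zero] at h

theorem commute_cshift_cesaroShift (m : ℤ) (z : Circle) (N : ℕ) :
    Commute (cshift m : CSeq Y →L[ℝ] CSeq Y) (cesaroShift n z N) :=
  commute_cesaro (commute_cshift_rescaledShift m z) N

variable [NeZero n]

/-- A sequence of elements that are asymptotically fixed by the rescaled shift is coordinatewise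
asymptotic to the quasi-periodic sequences with the same initial blocks. -/
theorem tendsto_coord_sub_quasiExt (z : Circle) {y : ℕ → CSeq Y}
    (hy : Tendsto (fun N => rescaledShift n z (y N) - y N) atTop (𝓝 0)) (k : ℤ) :
    Tendsto (fun N => coord k (y N - quasiExt n z (block n 0 (y N)))) atTop (𝓝 0) := by
  -- The quasi-periodic extension is fixed by the rescaled shift, so the difference e satisfies
  -- e(n+k) = z(e(k) + d(k)), where d is the defect that tends to zero. As e vanishes on the initial
  -- block, the limit propagates in both directions.
  have hstep : ∀ k N, coord ((n : ℤ) + k) (y N - quasiExt n z (block n 0 (y N))) =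
      scalar (z : ℂ) (coord k (y N - quasiExt n z (block n 0 (y N))) +
        coord k (rescaledShift n z (y N) - y N)) := fun k N => by
    rw [← map_add, ← coord_cscalar, ← coord_cshift]
    congr 1
    rw [sub_add_sub_comm, add_comm (y N), add_sub_add_right_eq_sub, rescaledShift_apply,
      map_sub, map_sub, cscalar_cscalar_inv, cshift_quasiExt]
  have hd : ∀ k, Tendsto (fun N => coord k (rescaledShift n z (y N) - y N)) atTop (𝓝 0) :=
    fun k => tendsto_map_zero _ hy
  refine forall_int_of_period (n := n)
    (P := fun k => Tendsto (fun N => coord k (y N - quasiExt n z (block n 0 (y N)))) atTop (𝓝 0))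
    (fun j => ?_) (fun k => ⟨fun h => ?_, fun h => ?_⟩) k
  · have : ∀ N, coord ((j : ℕ) : ℤ) (y N - quasiExt n z (block n 0 (y N))) = 0 := fun N => by
      have h := congrFun (block_zero_quasiExt z (block n 0 (y N))) j
      rw [block_apply, block_apply, mul_zero, zero_add] at h
      rw [map_sub, h, sub_self]
    simp only [this, tendsto_const_nhds]
  · simp only [hstep]
    have h1 := h.add (hd k)
    rw [add_zero] at h1
    exact tendsto_map_zero _ h1
  · have h1 : ∀ N, coord k (y N - quasiExt n z (block n 0 (y N))) =
        scalar ((z⁻¹ : Circle) : ℂ)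
          (coord ((n : ℤ) + k) (y N - quasiExt n z (block n 0 (y N)))) -
        coord k (rescaledShift n z (y N) - y N) := fun N => by
      rw [hstep, scalar_inv_scalar, add_sub_cancel_right]
    have h2 := (tendsto_map_zero (scalar ((z⁻¹ : Circle) : ℂ)) h).sub (hd k)
    rw [sub_zero] at h2
    exact h2.congr fun N => (h1 N).symm

/-- By translation, the norm of an operator that commutes with `S(n)` is detected on the block
`0, …, n - 1`. -/
theorem exists_lt_norm_coord {C : CSeq Y →L[ℝ] CSeq Y} (hCU : Commute C (cshift n))
    {z : Circle} {ε : ℝ} (hε : 0 < ε) {N : ℕ} (hN : ε < ‖C * cesaroShift n z N‖) :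
    ∃ (x : CSeq Y) (r : Fin n), ‖x‖ ≤ 4 ∧
      ε / 2 < ‖coord (r : ℕ) (C (cesaroShift n z N x))‖ := by
  obtain ⟨x, hx1, hx2⟩ := ContinuousLinearMap.exists_lt_apply_of_lt_opNorm _ hN
  rw [CSeq.mul_apply] at hx2
  obtain ⟨k, hk⟩ : ∃ k, ε / 2 < ‖coord k (C (cesaroShift n z N x))‖ := by
    by_contra! h
    have h2 := norm_le_of_coord_le (half_pos hε).le h
    rw [mul_div_cancel₀ _ (two_ne_zero' ℝ)] at h2
    exact h2.not_gt hx2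
  -- Translating x by a multiple of n moves the large coordinate k into the initial block; the bound
  -- 4 is that of the shift.
  refine ⟨cshift (n * (k / n)) x, residue n k,
    (norm_cshift_le _ x).trans (mul_le_of_le_one_right (by norm_num) hx1.le), ?_⟩
  rw [apply_comm (commute_cshift_cesaroShift _ z N).symm,
    apply_comm (commute_cshift_mul hCU (k / n)), coord_cshift, mul_ediv_add_residue]
  exact hk

/-- If `C` commutes with `S(n)`, preserves bounded coordinatewise null sequences and vanishes on the
sequences with `x_{n+k} = z x_k`, then its products with Cesàro means of the rescaled shift become
arbitrarily small. -/
theorem exists_norm_mul_cesaro_le {C : CSeq Y →L[ℝ] CSeq Y}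
    (hC : PreservesNull C) (hCU : Commute C (cshift n)) {z : Circle}
    (hCz : ∀ x : Fin n → Cplx Y, C (quasiExt n z x) = 0) {ε : ℝ} (hε : 0 < ε) :
    ∃ N, ‖C * cesaroShift n z N‖ ≤ ε := by
  by_contra! hcon
  choose x r hx hr using fun N => exists_lt_norm_coord hCU hε (hcon N)
  set y : ℕ → CSeq Y := fun N => cesaroShift n z N (x N) with hy
  have hy1 : Tendsto (fun N => rescaledShift n z (y N) - y N) atTop (𝓝 0) := by
    have h0 : Tendsto (fun N : ℕ => ((N : ℝ) + 1)⁻¹ * (17 * 4)) atTop (𝓝 0) := by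
      simpa [one_div] using (tendsto_one_div_add_atTop_nhds_zero_nat (𝕜 := ℝ)).mul_const (17 * 4)
    refine squeeze_zero_norm (fun N => ?_) h0
    refine (norm_rescaledShift_cesaroShift_sub_le z N (x N)).trans ?_
    gcongr
    exact hx N
  have hyb : ∀ N, ‖y N‖ ≤ 16 * 4 := fun N =>
    (norm_cesaroShift_apply_le z N (x N)).trans (by linarith [hx N])
  have hlim := hC (fun N => y N - quasiExt n z (block n 0 (y N)))
    ⟨16 * 4 + ‖quasiExt (Y := Y) n z‖ * (‖block (Y := Y) n 0‖ * (16 * 4)), fun N =>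
      (norm_sub_le _ _).trans (add_le_add (hyb N)
        (ContinuousLinearMap.le_opNorm_of_le _ (ContinuousLinearMap.le_opNorm_of_le _ (hyb N))))⟩
    (tendsto_coord_sub_quasiExt z hy1)
  simp only [map_sub, hCz, sub_zero] at hlim
  -- The index `r N` varies with N, but the block is finite, so the convergence is uniform over it.
  have hall : ∀ᶠ N in atTop, ∀ j : Fin n, ‖coord (j : ℕ) (C (y N))‖ < ε / 2 :=
    eventually_all.2 fun j =>
      (tendsto_zero_iff_norm_tendsto_zero.1 (hlim (j : ℕ))).eventually_lt_const (half_pos hε)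
  obtain ⟨N, hN⟩ := hall.exists
  exact lt_asymm (hN (r N)) (hr N)

end PreservesNull

/-! ### The algebra of complexified periodic operators -/

section PeriodicAlgebra

open Cplx CSeq

variable {Y : Type*} [NormedAddCommGroup Y] [NormedSpace ℝ Y]

variable (Y) in
/-- The complex-linear operators on complexified bounded sequences that commute with `S(n)`. -/
def periodicAlgebra (n : ℕ) : Subalgebra ℝ (CSeq Y →L[ℝ] CSeq Y) :=
  Subalgebra.centralizer ℝ {cimul Y, cshift n}

theorem mem_periodicAlgebra_iff {n : ℕ} {T : CSeq Y →L[ℝ] CSeq Y} :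
    T ∈ periodicAlgebra Y n ↔ Commute (cimul Y) T ∧ Commute (cshift n) T := by
  rw [periodicAlgebra, Subalgebra.mem_centralizer_iff]
  simp only [Set.mem_insert_iff, Set.mem_singleton_iff, forall_eq_or_imp, forall_eq]
  rfl

instance (n : ℕ) [CompleteSpace Y] : CompleteSpace (periodicAlgebra Y n) := by
  have h : IsClosed (periodicAlgebra Y n : Set (CSeq Y →L[ℝ] CSeq Y)) :=
    Set.isClosed_centralizer _
  exact h.completeSpace_coe

theorem cscalar_I : cscalar Complex.I = cimul Y := Complex.liftAux_apply_I _ _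

theorem commute_cimul {T : CSeq Y →L[ℝ] CSeq Y}
    (hT : ∀ (w : ℂ) x, T (cscalar w x) = cscalar w (T x)) : Commute (cimul Y) T :=
  ContinuousLinearMap.ext fun x => by
    rw [← cscalar_I, CSeq.mul_apply, CSeq.mul_apply, hT]

theorem commute_cimul_cshift (m : ℤ) : Commute (cimul Y) (cshift m) :=
  commute_cimul (cshift_cscalar m)

theorem norm_cshift_opNorm_le (m : ℤ) : ‖(cshift m : CSeq Y →L[ℝ] CSeq Y)‖ ≤ 4 :=
  ContinuousLinearMap.opNorm_le_bound _ (by norm_num) (norm_cshift_le m)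

namespace periodicAlgebra

variable (Y) (n : ℕ)

/-- The shift `S(n)`. -/
def shiftElem : periodicAlgebra Y n :=
  ⟨cshift n, mem_periodicAlgebra_iff.2 ⟨commute_cimul_cshift n, Commute.refl _⟩⟩

/-- The inverse of the shift `S(n)`. -/
def shiftInv : periodicAlgebra Y n :=
  ⟨cshift (-n), mem_periodicAlgebra_iff.2
    ⟨commute_cimul_cshift (-n), commute_cshift_cshift n (-n)⟩⟩

/-- The imaginary unit. -/
def imagUnit : periodicAlgebra Y n :=
  ⟨cimul Y, mem_periodicAlgebra_iff.2 ⟨Commute.refl _, (commute_cimul_cshift n).symm⟩⟩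

theorem commute_shiftElem (T : periodicAlgebra Y n) : Commute (shiftElem Y n) T :=
  Subtype.ext (mem_periodicAlgebra_iff.1 T.2).2.eq

theorem commute_imagUnit (T : periodicAlgebra Y n) : Commute (imagUnit Y n) T :=
  Subtype.ext (mem_periodicAlgebra_iff.1 T.2).1.eq

theorem imagUnit_mul_imagUnit : imagUnit Y n * imagUnit Y n = -1 :=
  Subtype.ext (cimul_mul_cimul Y)

theorem shiftInv_mul_shiftElem : shiftInv Y n * shiftElem Y n = 1 := by
  refine Subtype.ext ?_
  change (cshift (-n) : CSeq Y →L[ℝ] CSeq Y) * cshift n = 1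
  rw [cshift_mul_cshift, neg_add_cancel, cshift_zero]

theorem norm_shiftElem_pow_le (k : ℕ) : ‖shiftElem Y n ^ k‖ ≤ 4 := by
  change ‖(cshift n : CSeq Y →L[ℝ] CSeq Y) ^ k‖ ≤ 4
  rw [cshift_pow]
  exact norm_cshift_opNorm_le _

theorem norm_shiftInv_pow_le (k : ℕ) : ‖shiftInv Y n ^ k‖ ≤ 4 := by
  change ‖(cshift (-n) : CSeq Y →L[ℝ] CSeq Y) ^ k‖ ≤ 4
  rw [cshift_pow]
  exact norm_cshift_opNorm_le _

theorem coe_liftAux (z : ℂ) :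
    ((Complex.liftAux (imagUnit Y n) (imagUnit_mul_imagUnit Y n) z : periodicAlgebra Y n) :
      CSeq Y →L[ℝ] CSeq Y) = cscalar z := by
  rw [cscalar, Complex.liftAux_apply, Complex.liftAux_apply]
  rfl

variable {Y n}

theorem apply_cscalar {T : CSeq Y →L[ℝ] CSeq Y} (hT : T ∈ periodicAlgebra Y n) (w : ℂ)
    (x : CSeq Y) : T (cscalar w x) = cscalar w (T x) := by
  refine apply_comm (Commute.symm ?_) x
  rw [← coe_liftAux Y n]
  exact congrArg Subtype.val (commute_liftAux (commute_imagUnit Y n) (imagUnit_mul_imagUnit Y n) w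
    ⟨T, hT⟩).eq

theorem coe_cesaro (v : periodicAlgebra Y n) (N : ℕ) :
    ((cesaro v N : periodicAlgebra Y n) : CSeq Y →L[ℝ] CSeq Y) =
      cesaro (v : CSeq Y →L[ℝ] CSeq Y) N := by
  change (periodicAlgebra Y n).val (cesaro v N) = _
  rw [cesaro, map_smul, map_sum]
  simp only [map_pow]
  rfl

/-- An operator that preserves null sequences and vanishes on the sequences with `x_{n+k} = z x_k`
lies in the closed ideal generated by `S(n) - z`. -/
theorem mem_closure_of_vanishes [NeZero n] (C : periodicAlgebra Y n) {T : CSeq Y →L[ℝ] CSeq Y}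
    (hCT : (C : CSeq Y →L[ℝ] CSeq Y) = T) (hC : PreservesNull T) (z : Circle)
    (hCz : ∀ x : Fin n → Cplx Y, T (quasiExt n z x) = 0) :
    C ∈ closure (Set.range fun d => d *
      (shiftElem Y n - Complex.liftAux (imagUnit Y n) (imagUnit_mul_imagUnit Y n) z)) := by
  subst hCT
  refine mem_closure_of_mul_cesaro _ z fun ε hε => ?_
  obtain ⟨N, hN⟩ :=
    exists_norm_mul_cesaro_le hC (mem_periodicAlgebra_iff.1 C.2).2.symm hCz hε
  refine ⟨N, ?_⟩
  change ‖((C * cesaro _ N : periodicAlgebra Y n) : CSeq Y →L[ℝ] CSeq Y)‖ ≤ ε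
  rw [Subalgebra.coe_mul, coe_cesaro, Subalgebra.coe_mul, coe_liftAux]
  exact hN

end periodicAlgebra

end PeriodicAlgebra

/-! ### Symbols and blockwise operators -/

section Symbol

open Cplx CSeq

variable {Y : Type*} [NormedAddCommGroup Y] [NormedSpace ℝ Y] {n : ℕ}

theorem complexify_mem_periodicAlgebra {B : LInfty Y →L[ℝ] LInfty Y}
    (hB : (shift n).comp B = B.comp (shift n)) :
    complexify B ∈ periodicAlgebra Y n :=
  mem_periodicAlgebra_iff.2 ⟨commute_cimul (complexify_cscalar B),
    congrArg (fun T : LInfty Y →L[ℝ] LInfty Y => complexify T) hB⟩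

theorem norm_block_apply_le (q : ℤ) (x : CSeq Y) : ‖block n q x‖ ≤ 2 * ‖x‖ :=
  (pi_norm_le_iff_of_nonneg (by positivity)).2 fun _ => norm_coord_le _ x

theorem block_add_one (q : ℤ) (x : CSeq Y) : block n (q + 1) x = block n q (cshift n x) := by
  funext j
  rw [block_apply, block_apply, coord_cshift]
  congr 2
  ring

variable [NeZero n]

/-- The operator on blocks that is induced by the action of `T` on the sequences with
`x_{n+k} = z x_k`. -/
def symbol (T : CSeq Y →L[ℝ] CSeq Y) (z : Circle) : (Fin n → Cplx Y) →L[ℝ] (Fin n → Cplx Y) :=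
  (block n 0).comp (T.comp (quasiExt n z))

theorem symbol_apply (T : CSeq Y →L[ℝ] CSeq Y) (z : Circle) (x : Fin n → Cplx Y) :
    symbol T z x = block n 0 (T (quasiExt n z x)) := rfl

theorem apply_quasiExt_eq {T : CSeq Y →L[ℝ] CSeq Y} (hT : T ∈ periodicAlgebra Y n) (z : Circle)
    (x : Fin n → Cplx Y) : T (quasiExt n z x) = quasiExt n z (symbol T z x) :=
  apply_quasiExt (mem_periodicAlgebra_iff.1 hT).2.symm (periodicAlgebra.apply_cscalar hT) z x

/-- T maps the eigenspace into itself, so cutting down to the initial block and extending again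
between T and S loses nothing. -/
theorem symbol_symbol {S T : CSeq Y →L[ℝ] CSeq Y} (hT : T ∈ periodicAlgebra Y n)
    (hST : S * T = 1) (z : Circle) (x : Fin n → Cplx Y) : symbol S z (symbol T z x) = x := by
  rw [symbol_apply, ← apply_quasiExt_eq hT, ← CSeq.mul_apply, hST]
  exact block_zero_quasiExt z x

theorem symbol_scalarPi {T : CSeq Y →L[ℝ] CSeq Y} (hT : T ∈ periodicAlgebra Y n) (z : Circle)
    (w : ℂ) (x : Fin n → Cplx Y) : symbol T z (scalarPi n w x) = scalarPi n w (symbol T z x) := by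
  rw [symbol_apply, symbol_apply, quasiExt_scalarPi, periodicAlgebra.apply_cscalar hT,
    block_cscalar]

/-- The operator that acts as `D` on each block of length `n`. -/
def blockwise (D : (Fin n → Cplx Y) →L[ℝ] (Fin n → Cplx Y)) : CSeq Y →L[ℝ] CSeq Y :=
  ofCoords (fun k => (ContinuousLinearMap.proj (residue n k)).comp (D.comp (block n (k / n))))
    (‖D‖ * 2) fun k x => (norm_le_pi_norm (D (block n (k / n) x)) (residue n k)).trans
      ((D.le_opNorm_of_le (norm_block_apply_le _ x)).trans_eq (mul_assoc _ _ _).symm)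

variable {D : (Fin n → Cplx Y) →L[ℝ] (Fin n → Cplx Y)}

theorem coord_blockwise (k : ℤ) (x : CSeq Y) :
    coord k (blockwise D x) = D (block n (k / n) x) (residue n k) := rfl

theorem blockwise_mem_periodicAlgebra
    (hD : ∀ (w : ℂ) x, D (scalarPi n w x) = scalarPi n w (D x)) :
    blockwise D ∈ periodicAlgebra Y n := by
  refine mem_periodicAlgebra_iff.2 ⟨commute_cimul fun w x => ext_coord fun k => ?_,
    ContinuousLinearMap.ext fun x => ext_coord fun k => ?_⟩
  · rw [coord_cscalar, coord_blockwise, coord_blockwise, block_cscalar, hD, scalarPi_apply]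
  · rw [CSeq.mul_apply, CSeq.mul_apply, coord_cshift, coord_blockwise, coord_blockwise,
      add_ediv_period, residue_add_period]
    rw [block_add_one]

/-- On the eigenspace for z the block q is z^q times the initial one, so complex linearity of D
makes D the symbol of `blockwise D` at every z. -/
theorem blockwise_quasiExt (hD : ∀ (w : ℂ) x, D (scalarPi n w x) = scalarPi n w (D x))
    (z : Circle) (x : Fin n → Cplx Y) : blockwise D (quasiExt n z x) = quasiExt n z (D x) := by
  refine ext_coord fun k => ?_
  rw [coord_blockwise, block_quasiExt, hD, scalarPi_apply, coord_quasiExt]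

/-- Each output coordinate depends on only n input coordinates. -/
theorem preservesNull_blockwise : PreservesNull (blockwise D) := fun x _ hx k => by
  simp only [coord_blockwise]
  have h : Filter.Tendsto (fun m => block n (k / n) (x m)) Filter.atTop (nhds 0) :=
    tendsto_pi_nhds.2 fun j => hx _
  exact (tendsto_pi_nhds.1 (tendsto_map_zero D h)) (residue n k)

/-- A complexified periodic operator all of whose symbols are invertible is invertible. -/
theorem isUnit_of_symbol [CompleteSpace Y] {T : CSeq Y →L[ℝ] CSeq Y}
    (hmem : T ∈ periodicAlgebra Y n) (hT : PreservesNull T)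
    (h : ∀ z : Circle, ∃ D : (Fin n → Cplx Y) →L[ℝ] (Fin n → Cplx Y),
      (∀ x, D (symbol T z x) = x) ∧ ∀ x, symbol T z (D x) = x) : IsUnit T := by
  suffices key : IsUnit (⟨T, hmem⟩ : periodicAlgebra Y n) from
    key.map (periodicAlgebra Y n).val
  refine isUnit_of_forall_circle (periodicAlgebra.commute_shiftElem Y n)
    (periodicAlgebra.commute_imagUnit Y n) (periodicAlgebra.imagUnit_mul_imagUnit Y n)
    (periodicAlgebra.shiftInv_mul_shiftElem Y n) (periodicAlgebra.norm_shiftElem_pow_le Y n)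
    (periodicAlgebra.norm_shiftInv_pow_le Y n) fun z => ?_
  obtain ⟨D, hD1, hD2⟩ := h z
  -- D is only assumed real-linear, but the inverse of a complex-linear map is complex-linear; this
  -- puts `blockwise D` into the algebra.
  have hD : ∀ (w : ℂ) x, D (scalarPi n w x) = scalarPi n w (D x) := fun w x => by
    conv_lhs => rw [← hD2 x]
    rw [← symbol_scalarPi hmem, hD1]
  refine ⟨⟨blockwise D, blockwise_mem_periodicAlgebra hD⟩,
    periodicAlgebra.mem_closure_of_vanishes _ (T := blockwise D * T - 1) (by rfl)
      (preservesNull_blockwise.mul hT).sub_one z fun x => ?_,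
    periodicAlgebra.mem_closure_of_vanishes _ (T := T * blockwise D - 1) (by rfl)
      (hT.mul preservesNull_blockwise).sub_one z fun x => ?_⟩
  · change blockwise D (T (quasiExt n z x)) - quasiExt n z x = 0
    rw [apply_quasiExt_eq hmem, blockwise_quasiExt hD, hD1, sub_self]
  · change T (blockwise D (quasiExt n z x)) - quasiExt n z x = 0
    rw [blockwise_quasiExt hD, apply_quasiExt_eq hmem, hD2, sub_self]

theorem fourierTransform_eq_symbol (B : LInfty Y →L[ℝ] LInfty Y) (M : Circle)
    (x : Fin n → Cplx Y) :
    fourierTransform n B M x = symbol (complexify B) (M ^ n) (twist n M x) :=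
  fourierTransform_apply B M x

theorem complexify_mul_complexify {B D : LInfty Y →L[ℝ] LInfty Y}
    (h : B.comp D = ContinuousLinearMap.id ℝ _) :
    complexify B * complexify D = 1 :=
  congrArg (fun T : LInfty Y →L[ℝ] LInfty Y => complexify T) h

/-- A real operator whose complexification is invertible is invertible. -/
theorem exists_inverse_of_isUnit_complexify {B : LInfty Y →L[ℝ] LInfty Y}
    (h : IsUnit (complexify B)) :
    ∃ D : LInfty Y →L[ℝ] LInfty Y,
      B.comp D = ContinuousLinearMap.id ℝ _ ∧ D.comp B = ContinuousLinearMap.id ℝ _ := by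
  obtain ⟨⟨T, R, hTR, hRT⟩, hT⟩ := h
  change T = _ at hT
  subst hT
  let incl : LInfty Y →L[ℝ] CSeq Y :=
    ((equiv Y).symm : Cplx (LInfty Y) →L[ℝ] CSeq Y).comp
      (((WithLp.prodContinuousLinearEquiv 2 ℝ (LInfty Y) (LInfty Y)).symm :
        LInfty Y × LInfty Y →L[ℝ] Cplx (LInfty Y)).comp
        (ContinuousLinearMap.inl ℝ (LInfty Y) (LInfty Y)))
  let re : CSeq Y →L[ℝ] LInfty Y :=
    (ContinuousLinearMap.fst ℝ (LInfty Y) (LInfty Y)).comp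
      ((WithLp.prodContinuousLinearEquiv 2 ℝ (LInfty Y) (LInfty Y) :
        Cplx (LInfty Y) →L[ℝ] LInfty Y × LInfty Y).comp
        (equiv Y : CSeq Y →L[ℝ] Cplx (LInfty Y)))
  have hre : ∀ x, B (re x) = re (complexify B x) := fun x => rfl
  have hincl : ∀ x, incl (B x) = complexify B (incl x) := fun x =>
    (equiv Y).injective (Cplx.ext rfl (map_zero B).symm)
  have hri : ∀ x, re (incl x) = x := fun x => rfl
  -- The real part of the complex inverse on real sequences works because the complexification
  -- intertwines with both the inclusion and the real part.
  refine ⟨re.comp (R.comp incl), ContinuousLinearMap.ext fun x => ?_,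
    ContinuousLinearMap.ext fun x => ?_⟩
  · change B (re (R (incl x))) = x
    rw [hre, ← CSeq.mul_apply, hTR]
    exact hri x
  · change re (R (incl (B x))) = x
    rw [hincl, ← CSeq.mul_apply, hRT]
    exact hri x

end Symbol

theorem Circle.exists_pow_eq {n : ℕ} (hn : n ≠ 0) (z : Circle) : ∃ M : Circle, M ^ n = z := by
  refine ⟨Circle.exp (Complex.arg z / n), ?_⟩
  rw [← Circle.exp_nsmul, nsmul_eq_mul, mul_div_cancel₀ _ (by exact_mod_cast hn), Circle.exp_arg]

end

theorem theorem82 (v : ℕ) (hv₂ : 2 ≤ v) (hv₃ : v ≤ 3)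
    {Y : Type*} [NormedAddCommGroup Y] [NormedSpace ℝ Y] [CompleteSpace Y] [CayleyDicksonSpace v Y]
    (n : ℕ) [NeZero n] (B : LInfty Y →L[ℝ] LInfty Y) (hB : IsPeriodicOperator n B) :
    (∃ D : LInfty Y →L[ℝ] LInfty Y,
        B.comp D = ContinuousLinearMap.id ℝ _ ∧ D.comp B = ContinuousLinearMap.id ℝ _) ↔
      ∀ M : Circle, ∃ D : (Fin n → Cplx Y) →L[ℝ] (Fin n → Cplx Y),
        (fourierTransform n B M).comp D = ContinuousLinearMap.id ℝ _ ∧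
          D.comp (fourierTransform n B M) = ContinuousLinearMap.id ℝ _ := by
  have hBmem := complexify_mem_periodicAlgebra hB.2
  constructor
  · rintro ⟨D, hBD, hDB⟩ M
    -- Commutation with the shift passes to the inverse, so D has symbols too; its c-continuity is
    -- not needed here.
    have hD : (shift n).comp D = D.comp (shift n) := by
      calc (shift n).comp D = (D.comp B).comp ((shift n).comp D) := by
            rw [hDB, ContinuousLinearMap.id_comp]
        _ = D.comp ((B.comp (shift n)).comp D) := rfl
        _ = D.comp (((shift n).comp B).comp D) := by rw [hB.2]
        _ = (D.comp (shift n)).comp (B.comp D) := rfl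
        _ = D.comp (shift n) := by rw [hBD, ContinuousLinearMap.comp_id]
    have hDmem := complexify_mem_periodicAlgebra hD
    refine ⟨(twist n M⁻¹).comp (symbol (CSeq.complexify D) (M ^ n)),
      ContinuousLinearMap.ext fun x => ?_, ContinuousLinearMap.ext fun x => ?_⟩
    · change fourierTransform n B M (twist n M⁻¹ (symbol (CSeq.complexify D) (M ^ n) x)) = x
      rw [fourierTransform_eq_symbol, twist_twist_inv,
        symbol_symbol hDmem (complexify_mul_complexify hBD)]
    · change twist n M⁻¹ (symbol (CSeq.complexify D) (M ^ n) (fourierTransform n B M x)) = x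
      rw [fourierTransform_eq_symbol, symbol_symbol hBmem (complexify_mul_complexify hDB),
        twist_inv_twist]
  · intro h
    refine exists_inverse_of_isUnit_complexify
      (isUnit_of_symbol hBmem hB.1.preservesNull_complexify fun z => ?_)
    obtain ⟨M, rfl⟩ := Circle.exists_pow_eq (NeZero.ne n) z
    obtain ⟨D, hFD, hDF⟩ := h M
    have hFD' : ∀ x, fourierTransform n B M (D x) = x := fun x =>
      congrArg (fun T : (Fin n → Cplx Y) →L[ℝ] (Fin n → Cplx Y) => T x) hFD
    have hDF' : ∀ x, D (fourierTransform n B M x) = x := fun x =>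
      congrArg (fun T : (Fin n → Cplx Y) →L[ℝ] (Fin n → Cplx Y) => T x) hDF
    -- The Fourier transform is the symbol at M^n after the twist, so the symbol is inverted by the
    -- twist after D.
    refine ⟨(twist n M).comp D, fun x => ?_, fun x => ?_⟩
    · change twist n M (D (symbol (CSeq.complexify B) (M ^ n) x)) = x
      have hx := hDF' (twist n M⁻¹ x)
      rw [fourierTransform_eq_symbol, twist_twist_inv] at hx
      rw [hx, twist_twist_inv]
    · change symbol (CSeq.complexify B) (M ^ n) (twist n M (D x)) = x
      rw [← fourierTransform_eq_symbol, hFD']
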